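/- **Proposition.** *Setting.* Let $q\in[1/2,1)$. Ordering $a\in[0,1]$ under demand $D\in[0,1]$ costs $c(a,D)=(1-q)(a-D)^++q(D-a)^+$. For a probability distribution $F$ on $[0,1]$ put $c(a,F)=\mathbb E_{D\sim F}[c(a,D)]$ and $R(a,F)=c(a,F)-\min_{a'\in[0,1]}c(a',F)$. A design consists of $K\ge1$, positive integers $\boldsymbol n=(n_1,\dots,n_K)$ and inventory levels $0\le x_1\le\cdots\le x_K\le1$; it produces the sales $S^{(k)}_i=\min\{D^{(k)}_i,x_k\}$, $1\le i\le n_k$, with i.i.d. demands $D^{(k)}_i\sim F$. BSAA orders $\pi=\inf\{u\in[0,1]:\hat F(u)\ge q\}$, where $\hat F$ is the empirical distribution function of all the sales, and $\mathsf{Reg}(\boldsymbol n\mid\boldsymbol x)=\sup_F\mathbb E[R(\pi,F)]$, the supremum being over all distributions $F$ on $[0,1]$. For an integer budget $B\ge1$ let $$\mathcal P(B)=\inf\Big\{\mathsf{Reg}(\boldsymbol n\mid\boldsymbol x):(K,\boldsymbol n,\boldsymbol x)\text{ a design with }\textstyle\sum_k n_kx_k\le B\Big\}.$$ Let $\bar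 U=\mathsf{Reg}((B)\mid(1))$ be the worst-case regret of the design $K=1$, $n_1=B$, $x_1=1$, and $N_{\max}=\big\lceil B/\big((1-q)(1-\bar U/q)\big)\big\rceil$. For $N\ge1$, $0\le k\le N$ and $t\in[0,1]$ let $$\psi^{(N)}_k(t)=\Big(1-\Pr\big[\mathrm{Bin}(N-k,t)\ge\lceil qN\rceil-k\big]\Big)(t-q)+(q-t)^+ .$$ For finite grids $V\subset[0,q]$ and $W\subset[q,1]$, and with the conventions $x_0=0$, $x_{N+1}=1$, let $\hat{\mathcal P}_N(B;V,W)$ be the infimum, over $0\le x_1\le\cdots\le x_N\le1$ with $\sum_jx_j\le B$, of $$\max_{0\le m\le N+1}\Big\{\max_{v\in V}\sum_{k<m}(x_{k+1}-x_k)\psi^{(N)}_k(v)+\max_{w\in W}\sum_{k=m}^{N}(x_{k+1}-x_k)\psi^{(N)}_k(w)\Big\}.$$ The associated epigraph linear program has the variables $\boldsymbol x$, $t$, $(\alpha_m,\beta_m)_{m=0}^{N+1}$. It minimises $t$ subject to $0\le x_1\le\cdots\le x_N\le1$, $\sum_jx_j\le B$ and, for all $m$, $v\in V$, $w\in W$: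 $\alpha_m\ge\sum_{k<m}(x_{k+1}-x_k)\psi^{(N)}_k(v)$, $\beta_m\ge\sum_{k=m}^{N}(x_{k+1}-x_k)\psi^{(N)}_k(w)$, $t\ge\alpha_m+\beta_m$. *Claim.* One has $\bar U<q$ and $N_{\max}\ge1$. Let $\varepsilon>0$ and $\delta=\varepsilon/(2(N_{\max}+2))$. For every $N=1,\dots,N_{\max}$ let $V_N$ and $W_N$ be uniform grids of $[0,q]$ and of $[q,1]$, containing both endpoints, with mesh at most $\delta$. Then: 1. for each $N=1,\dots,N_{\max}$ the epigraph linear program for $V_N,W_N$ has an optimal solution, and its optimal value is $\hat{\mathcal P}_N(B;V_N,W_N)$; 2. with $\hat{\mathcal P}(B)=\min_{1\le N\le N_{\max}}\hat{\mathcal P}_N(B;V_N,W_N)$, $$\hat{\mathcal P}(B)\le\mathcal P(B)\le\hat{\mathcal P}(B)+\varepsilon;$$ 3. if $\hat{\boldsymbol x}^{(N)}$ is the $\boldsymbol x$-part of any optimal solution of the $N$-th program and $\hat N$ is any minimiser of $N\mapsto\hat{\mathcal P}_N(B;V_N,W_N)$ over $1\le N\le N_{\max}$, then $\hat{\mathcal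 P}_{\hat N}(B;V_{\hat N},W_{\hat N})=\hat{\mathcal P}(B)$, the returned design $\big(\hat N,(1,\dots,1),\hat{\boldsymbol x}^{(\hat N)}\big)$ is feasible for $\mathcal P(B)$, and it is $\varepsilon$-optimal: $\mathsf{Reg}\big((1,\dots,1)\mid\hat{\boldsymbol x}^{(\hat N)}\big)\le\mathcal P(B)+\varepsilon$. -/

import Mathlib

open MeasureTheory

noncomputable section

namespace Newsvendor

/-! ### Newsvendor costs and regret
Costs are normalised by `c_u + c_o = 1`, so that `c_u = q` and `c_o = 1 - q`. -/

/-- The set `Δ([0,1])` of demand distributions. -/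
abbrev DemandDist : Type := ProbabilityMeasure (Set.Icc (0 : ℝ) 1)

/-- Cost `c(a, D) = c_o (a - D)^+ + c_u (D - a)^+` of ordering `a` when the demand is `D`. -/
def cost (q a D : ℝ) : ℝ := (1 - q) * max (a - D) 0 + q * max (D - a) 0

/-- Expected cost `c(a, F)`. -/
def expectedCost (q a : ℝ) (F : DemandDist) : ℝ :=
  ∫ D, cost q a (D : ℝ) ∂(F : Measure (Set.Icc (0 : ℝ) 1))

/-- Optimal cost `opt(F)`, the minimum over `a ∈ [0,1]` of `c(a, F)`. -/
def opt (q : ℝ) (F : DemandDist) : ℝ := ⨅ a : Set.Icc (0 : ℝ) 1, expectedCost q (a : ℝ) F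

/-- Regret `R(a, F) = c(a, F) - opt(F)`. -/
def regret (q a : ℝ) (F : DemandDist) : ℝ := expectedCost q a F - opt q F

/-! ### Censored data and data-driven policies -/

/-- Labels `(k, i)` of the samples: `n k` samples are collected at the `k`-th inventory level. -/
abbrev SampleIdx {K : ℕ} (n : Fin K → ℕ) : Type := Σ k : Fin K, Fin (n k)

/-- A data-driven policy: it maps the inventory levels and the information (sales, indicator that
the demand was at most the inventory) of every sample to an order quantity. -/
abbrev Policy {K : ℕ} (n : Fin K → ℕ) : Type :=
  (Fin K → ℝ) → (SampleIdx n → ℝ × Bool) → ℝ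

open Classical in
/-- The information `(min {D, x_k}, 1{D ≤ x_k})` generated by the demands `D` under the
inventory levels `x`. -/
def info {K : ℕ} {n : Fin K → ℕ} (x : Fin K → ℝ) (D : SampleIdx n → Set.Icc (0 : ℝ) 1) :
    SampleIdx n → ℝ × Bool :=
  fun s => (min (D s : ℝ) (x s.1), decide ((D s : ℝ) ≤ x s.1))

/-- Expected regret of a policy when all demands are i.i.d. with law `F`. -/
def expectedRegret (q : ℝ) {K : ℕ} {n : Fin K → ℕ} (π : Policy n) (x : Fin K → ℝ)
    (F : DemandDist) : ℝ :=
  ∫ D, regret q (π x (info x D)) F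
    ∂(Measure.pi fun _ : SampleIdx n => (F : Measure (Set.Icc (0 : ℝ) 1)))

/-- Worst-case regret `Reg(π ∣ x)`, the supremum over all demand distributions on `[0,1]`. -/
def worstCaseRegret (q : ℝ) {K : ℕ} {n : Fin K → ℕ} (π : Policy n) (x : Fin K → ℝ) : ℝ :=
  ⨆ F : DemandDist, expectedRegret q π x F

open Classical in
/-- Empirical distribution function of the pooled sales. -/
def empiricalCDF {K : ℕ} {n : Fin K → ℕ} (S : SampleIdx n → ℝ) (u : ℝ) : ℝ :=
  ((Finset.univ.filter fun s => S s ≤ u).card : ℝ) / (Fintype.card (SampleIdx n) : ℝ)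

/-- Biased sample average approximation: the empirical `q`-quantile of the sales. -/
def bsaa (q : ℝ) {K : ℕ} (n : Fin K → ℕ) : Policy n :=
  fun _ I => sInf {u : ℝ | u ∈ Set.Icc (0 : ℝ) 1 ∧ q ≤ empiricalCDF (fun s => (I s).1) u}

/-! ### The exploratory design problem -/

/-- Feasible designs `(K, n, x)` for the inventory budget `B`. -/
structure IsDesign (B : ℕ) {K : ℕ} (n : Fin K → ℕ) (x : Fin K → ℝ) : Prop where
  levels_pos : 1 ≤ K
  counts_pos : ∀ k, 1 ≤ n k
  mono : Monotone x
  mem : ∀ k, x k ∈ Set.Icc (0 : ℝ) 1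
  budget : ∑ k, (n k : ℝ) * x k ≤ (B : ℝ)

/-- The design value `P(B)`: infimum of the worst-case regret of BSAA over feasible designs. -/
def designValue (q : ℝ) (B : ℕ) : ℝ :=
  sInf {r : ℝ | ∃ (K : ℕ) (n : Fin K → ℕ) (x : Fin K → ℝ),
    IsDesign B n x ∧ r = worstCaseRegret q (bsaa q n) x}

/-- Worst-case regret `Ū(B, q)` of the uncensored design `(1, (B), (1))`. -/
def uncensoredRegret (q : ℝ) (B : ℕ) : ℝ :=
  worstCaseRegret q (bsaa q (fun _ : Fin 1 => B)) (fun _ => 1)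

/-- `N_max(B, q) = ⌈B / ((1 - q) (1 - Ū(B, q) / q))⌉`. -/
def Nmax (q : ℝ) (B : ℕ) : ℕ :=
  ⌈(B : ℝ) / ((1 - q) * (1 - uncensoredRegret q B / q))⌉₊

/-! ### The grid objective -/

/-- Bernstein tail: probability that a `Binomial(n, p)` variable is at least `r`
(the full sum, which is `1`, for `r ≤ 0`). -/
def bernsteinTail (r : ℤ) (n : ℕ) (p : ℝ) : ℝ :=
  ∑ j ∈ (Finset.range (n + 1)).filter (fun j : ℕ => r ≤ (j : ℤ)),
    (n.choose j : ℝ) * p ^ j * (1 - p) ^ (n - j)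

/-- `ψ_k^{(N)}(t)`, used for `0 ≤ k ≤ N`. -/
def psi (q : ℝ) (N k : ℕ) (t : ℝ) : ℝ :=
  (1 - bernsteinTail (⌈q * (N : ℝ)⌉ - (k : ℤ)) (N - k) t) * (t - q) + max (q - t) 0

/-- `x_j` for `0 ≤ j ≤ N + 1`, with the conventions `x_0 = 0` and `x_{N+1} = 1`. -/
def node {N : ℕ} (x : Fin N → ℝ) (j : ℕ) : ℝ :=
  if j = 0 then 0 else if h : j - 1 < N then x ⟨j - 1, h⟩ else 1

/-- `∑_{k < m} (x_{k+1} - x_k) ψ_k(v)`: the first `m` of the `N + 1` intervals at level `v`. -/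
def lowPart (q : ℝ) {N : ℕ} (x : Fin N → ℝ) (m : ℕ) (v : ℝ) : ℝ :=
  ∑ k ∈ Finset.range m, (node x (k + 1) - node x k) * psi q N k v

/-- `∑_{k = m}^{N} (x_{k+1} - x_k) ψ_k(w)`: the remaining intervals at level `w`. -/
def highPart (q : ℝ) {N : ℕ} (x : Fin N → ℝ) (m : ℕ) (w : ℝ) : ℝ :=
  ∑ k ∈ Finset.Ico m (N + 1), (node x (k + 1) - node x k) * psi q N k w

/-- The points `q a / M`, `a = 0, …, M`, of the uniform grid of `[0, q]` with mesh `q / M`. -/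
def gridV (q : ℝ) (M a : ℕ) : ℝ := q * (a : ℝ) / (M : ℝ)

/-- The points `q + (1 - q) b / M`, `b = 0, …, M`, of the uniform grid of `[q, 1]` with mesh
`(1 - q) / M`. -/
def gridW (q : ℝ) (M b : ℕ) : ℝ := q + (1 - q) * (b : ℝ) / (M : ℝ)

/-- The grid objective: the maximum over the number `m ∈ {0, …, N + 1}` of intervals to the left
of the crossing and over the grid points `v`, `w`. -/
def gridObjective (q : ℝ) {N : ℕ} (MV MW : ℕ) (x : Fin N → ℝ) : ℝ :=
  ⨆ m : Fin (N + 2), ((⨆ a : Fin (MV + 1), lowPart q x (m : ℕ) (gridV q MV a)) +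
    ⨆ b : Fin (MW + 1), highPart q x (m : ℕ) (gridW q MW b))

/-- `P̂_N(B; V, W)`: infimum of the grid objective over the feasible unit-count designs with
`N` samples. -/
def gridValue (q : ℝ) (B N MV MW : ℕ) : ℝ :=
  sInf {r : ℝ | ∃ x : Fin N → ℝ, IsDesign B (fun _ : Fin N => 1) x ∧ r = gridObjective q MV MW x}

/-! ### The epigraph linear program -/

/-- A linear program with finitely many real variables `V` and finitely many constraints `C`:
minimise `obj` subject to `con c z ≤ 0` for all `c`. -/
structure LinearProgram (V C : Type) [Fintype V] [Fintype C] where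
  obj : (V → ℝ) →ₗ[ℝ] ℝ
  con : C → ((V → ℝ) →ᵃ[ℝ] ℝ)

def LinearProgram.Feasible {V C : Type} [Fintype V] [Fintype C] (L : LinearProgram V C)
    (z : V → ℝ) : Prop := ∀ c, L.con c z ≤ 0

def LinearProgram.IsOptimal {V C : Type} [Fintype V] [Fintype C] (L : LinearProgram V C)
    (z : V → ℝ) : Prop := L.Feasible z ∧ ∀ z', L.Feasible z' → L.obj z ≤ L.obj z'

/-- Variables of the epigraph program. -/
inductive EpiVar (N : ℕ) : Type
  | x (j : Fin N)
  | t
  | α (m : Fin (N + 2))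
  | β (m : Fin (N + 2))
  deriving Fintype

/-- Constraints of the epigraph program. -/
inductive EpiCon (N MV MW : ℕ) : Type
  | order (j : Fin (N + 1))
  | budget
  | low (m : Fin (N + 2)) (a : Fin (MV + 1))
  | high (m : Fin (N + 2)) (b : Fin (MW + 1))
  | sum (m : Fin (N + 2))
  deriving Fintype

/-- A coordinate as an affine function of the variables. -/
def coord {V : Type} (v : V) : (V → ℝ) →ᵃ[ℝ] ℝ :=
  (LinearMap.proj v : (V → ℝ) →ₗ[ℝ] ℝ).toAffineMap

/-- `x_j`, `0 ≤ j ≤ N + 1`, as an affine function of the variables. -/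
def nodeAff (N : ℕ) (j : ℕ) : (EpiVar N → ℝ) →ᵃ[ℝ] ℝ :=
  if j = 0 then AffineMap.const ℝ _ 0
  else if h : j - 1 < N then coord (EpiVar.x ⟨j - 1, h⟩) else AffineMap.const ℝ _ 1

/-- The epigraph linear program: minimise `t` over `x, t, α, β` subject to
`0 ≤ x_1 ≤ ⋯ ≤ x_N ≤ 1`, `∑ x_j ≤ B`, `α_m ≥ lowPart` at every grid point of `[0, q]`,
`β_m ≥ highPart` at every grid point of `[q, 1]`, and `t ≥ α_m + β_m`. -/
def epigraphLP (q : ℝ) (B N MV MW : ℕ) : LinearProgram (EpiVar N) (EpiCon N MV MW) where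
  obj := LinearMap.proj EpiVar.t
  con
    | .order j => nodeAff N j - nodeAff N (j + 1)
    | .budget => (∑ j : Fin N, coord (EpiVar.x j)) - AffineMap.const ℝ _ (B : ℝ)
    | .low m a =>
        (∑ k ∈ Finset.range m, psi q N k (gridV q MV a) • (nodeAff N (k + 1) - nodeAff N k))
          - coord (EpiVar.α m)
    | .high m b =>
        (∑ k ∈ Finset.Ico (m : ℕ) (N + 1),
            psi q N k (gridW q MW b) • (nodeAff N (k + 1) - nodeAff N k))
          - coord (EpiVar.β m)
    | .sum m => coord (EpiVar.α m) + coord (EpiVar.β m) - coord EpiVar.t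

/-- The inventory levels encoded in a vector of variables. -/
def levels {N : ℕ} (z : EpiVar N → ℝ) : Fin N → ℝ := fun j => z (EpiVar.x j)

/-- `P̂(B)`: minimum of `P̂_N(B; V_N, W_N)` over `1 ≤ N ≤ N_max`. -/
def approxValue (q : ℝ) (B : ℕ) (MV MW : ℕ → ℕ) : ℝ :=
  sInf ((fun N => gridValue q B N (MV N) (MW N)) '' Set.Icc 1 (Nmax q B))

end Newsvendor

end

/-! A layer-cake computation gives R(a, F) = ∫_0^a (F - q) + ∫_0^1 (q - F)^+ (`regret_eq`). BSAA
orders at most u exactly when at least ⌈qN⌉ of the N sales are at most u. Samples whose level is at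
most u contribute surely, say k(u) of them; the other N - k(u) are independent trials with success
probability F(u). Hence the expected regret is ∫_0^1 ψ_{k(u)}(F(u)) du (`expectedRegret_bsaa`),
where k(u) is constant between consecutive levels. Only the multiset of levels matters, so
unit-count designs suffice (`exists_unit_design`).

The worst case is thus a maximisation over nondecreasing F. A distribution function equal to v
before the node x_m and to w after it yields `lowPart` + `highPart` (`lowPart_add_highPart_le`).
Conversely, on each side of the crossing of q one has ψ_k(s) ψ_l(t) ≤ ψ_k(t) ψ_l(s) for k ≤ l and s
≤ t. This total positivity runs against the monotonicity of F, so some constant level does at least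
as well as an increasing profile (`exists_sum_le_sum_const`), and two levels suffice
(`regretIntegral_le`). Each ψ_k is (N + 2)-Lipschitz and the cells have total length 1, so
restricting the two levels to the grids loses at most (N + 2)δ ≤ ε/2.

Large N is useless. Let r = ⌈qN⌉. If the demand is always 1, BSAA orders at most x_r, so the regret
is at least q(1 - x_r), while the budget forces (1 - q) N x_r ≤ B. For N ≥ N_max this regret is at
least that of the uncensored design, whose size B is itself at most N_max
(`uncensoredRegret_le_worstCaseRegret`, `budget_le_Nmax`).

For fixed N the grid objective is a finite maximum of affine functions on a compact polytope; the
linear program is its epigraph form. -/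

namespace Newsvendor

/-! ### Binomial tails -/

/-- Probability that a `Binomial(n, p)` variable is at most `f`. -/
noncomputable def binomCDF (f n : ℕ) (p : ℝ) : ℝ :=
  ∑ i ∈ Finset.range (f + 1), (n.choose i : ℝ) * p ^ i * (1 - p) ^ (n - i)

lemma binomCDF_eq_filter (f n : ℕ) (p : ℝ) :
    binomCDF f n p = ∑ i ∈ (Finset.range (n + 1)).filter (fun i => i ≤ f),
      (n.choose i : ℝ) * p ^ i * (1 - p) ^ (n - i) := by
  symm
  apply Finset.sum_subset
  · intro i hi
    simp only [Finset.mem_filter, Finset.mem_range] at hi ⊢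
    omega
  · intro i hi hi'
    simp only [Finset.mem_filter, Finset.mem_range] at hi hi'
    rw [Nat.choose_eq_zero_of_lt (by omega)]
    simp

lemma binom_total (n : ℕ) (p : ℝ) :
    ∑ i ∈ Finset.range (n + 1), (n.choose i : ℝ) * p ^ i * (1 - p) ^ (n - i) = 1 := by
  have h := add_pow p (1 - p) n
  rw [add_sub_cancel, one_pow] at h
  exact (Finset.sum_congr rfl fun i _ => by ring).trans h.symm

lemma one_sub_binomCDF (f n : ℕ) (p : ℝ) :
    1 - binomCDF f n p = ∑ i ∈ (Finset.range (n + 1)).filter (fun i => ¬ i ≤ f),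
      (n.choose i : ℝ) * p ^ i * (1 - p) ^ (n - i) := by
  rw [binomCDF_eq_filter, sub_eq_iff_eq_add', Finset.sum_filter_add_sum_filter_not, binom_total]

section
variable {f n : ℕ} {p : ℝ}

lemma binom_term_nonneg (h0 : 0 ≤ p) (h1 : p ≤ 1) (i : ℕ) :
    0 ≤ (n.choose i : ℝ) * p ^ i * (1 - p) ^ (n - i) := by
  have : 0 ≤ 1 - p := by linarith
  positivity

lemma binomCDF_nonneg (h0 : 0 ≤ p) (h1 : p ≤ 1) : 0 ≤ binomCDF f n p :=
  Finset.sum_nonneg fun i _ => binom_term_nonneg h0 h1 i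

lemma binomCDF_le_one (h0 : 0 ≤ p) (h1 : p ≤ 1) : binomCDF f n p ≤ 1 := by
  have := one_sub_binomCDF f n p
  have h : 0 ≤ 1 - binomCDF f n p := by
    rw [this]
    exact Finset.sum_nonneg fun i _ => binom_term_nonneg h0 h1 i
  linarith

lemma binomCDF_pos (h0 : 0 ≤ p) (h1 : p < 1) : 0 < binomCDF f n p := by
  have h2 : 0 < 1 - p := by linarith
  have := Finset.single_le_sum (f := fun i => (n.choose i : ℝ) * p ^ i * (1 - p) ^ (n - i))
    (fun i _ => binom_term_nonneg h0 h1.le i) (Finset.mem_range.2 (Nat.succ_pos f))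
  refine lt_of_lt_of_le ?_ this
  simp only [Nat.choose_zero_right]
  positivity

end

/-- The extra trial pushes the count past `f` exactly when it succeeds and the first `n` trials gave
`f` successes. -/
lemma binomCDF_succ (f n : ℕ) (p : ℝ) :
    binomCDF f (n + 1) p
      = binomCDF f n p - p * ((n.choose f : ℝ) * p ^ f * (1 - p) ^ (n - f)) := by
  induction f with
  | zero => simp [binomCDF]; ring
  | succ f ih =>
    unfold binomCDF at ih ⊢
    rw [Finset.sum_range_succ, ih, Finset.sum_range_succ _ (f + 1)]
    have e : n + 1 - (f + 1) = n - f := by omega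
    rw [e, Nat.choose_succ_succ]
    push_cast
    rcases Nat.lt_or_ge n (f + 1) with h | h
    · rw [Nat.choose_eq_zero_of_lt h]
      push_cast
      ring
    · have e' : n - f = n - (f + 1) + 1 := by omega
      rw [e']
      ring

lemma binomCDF_succ_succ (f n : ℕ) (p : ℝ) :
    binomCDF (f + 1) (n + 1) p
      = p * binomCDF f n p + (1 - p) * binomCDF (f + 1) n p := by
  rw [binomCDF_succ]
  have : binomCDF (f + 1) n p = binomCDF f n p
      + (n.choose (f + 1) : ℝ) * p ^ (f + 1) * (1 - p) ^ (n - (f + 1)) :=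
    Finset.sum_range_succ _ _
  rw [this]
  ring

lemma binomCDF_zero_succ (n : ℕ) (p : ℝ) :
    binomCDF 0 (n + 1) p = (1 - p) * binomCDF 0 n p := by
  simp [binomCDF]
  ring

lemma binomCDF_of_le {f n : ℕ} (h : n ≤ f) (p : ℝ) : binomCDF f n p = 1 := by
  rw [binomCDF_eq_filter, Finset.filter_true_of_mem, binom_total]
  intro i hi
  have := Finset.mem_range.1 hi
  omega

/-- Conditioning on one trial writes the function as a convex combination of two functions with one
trial fewer; changing the mixing weight costs at most |p - s|. A success lowers the threshold, so
the induction runs over all `f`. -/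
lemma abs_binomCDF_sub_le (n : ℕ) {p s : ℝ} (hp0 : 0 ≤ p) (hp1 : p ≤ 1) (hs0 : 0 ≤ s)
    (hs1 : s ≤ 1) (f : ℕ) : |binomCDF f n p - binomCDF f n s| ≤ n * |p - s| := by
  induction n generalizing f with
  | zero => simp [binomCDF_of_le]
  | succ n ih =>
    push_cast
    cases f with
    | zero =>
      rw [binomCDF_zero_succ, binomCDF_zero_succ]
      have e : (1 - p) * binomCDF 0 n p - (1 - s) * binomCDF 0 n s
        = (1 - p) * (binomCDF 0 n p - binomCDF 0 n s) - (p - s) * binomCDF 0 n s := by ring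
      rw [e]
      refine (abs_sub _ _).trans ?_
      rw [abs_mul, abs_mul, abs_of_nonneg (by linarith : 0 ≤ 1 - p),
        abs_of_nonneg (binomCDF_nonneg hs0 hs1 : 0 ≤ binomCDF 0 n s)]
      have h1 := mul_le_mul (by linarith : 1 - p ≤ 1) (ih 0) (abs_nonneg _) zero_le_one
      have h2 := mul_le_mul_of_nonneg_left (binomCDF_le_one hs0 hs1 : binomCDF 0 n s ≤ 1)
        (abs_nonneg (p - s))
      linarith
    | succ f =>
      rw [binomCDF_succ_succ, binomCDF_succ_succ]
      have e : p * binomCDF f n p + (1 - p) * binomCDF (f + 1) n p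
          - (s * binomCDF f n s + (1 - s) * binomCDF (f + 1) n s)
        = p * (binomCDF f n p - binomCDF f n s)
          + (1 - p) * (binomCDF (f + 1) n p - binomCDF (f + 1) n s)
          + (p - s) * (binomCDF f n s - binomCDF (f + 1) n s) := by ring
      rw [e]
      refine (abs_add_three _ _ _).trans ?_
      rw [abs_mul, abs_mul, abs_mul, abs_of_nonneg (by linarith : 0 ≤ 1 - p), abs_of_nonneg hp0]
      have h1 := mul_le_mul_of_nonneg_left (ih f) hp0
      have h2 := mul_le_mul_of_nonneg_left (ih (f + 1)) (by linarith : 0 ≤ 1 - p)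
      have h3 : |binomCDF f n s - binomCDF (f + 1) n s| ≤ 1 := by
        have a1 : 0 ≤ binomCDF f n s := binomCDF_nonneg hs0 hs1
        have a2 : binomCDF f n s ≤ 1 := binomCDF_le_one hs0 hs1
        have a3 : 0 ≤ binomCDF (f + 1) n s := binomCDF_nonneg hs0 hs1
        have a4 : binomCDF (f + 1) n s ≤ 1 := binomCDF_le_one hs0 hs1
        rw [abs_le]; constructor <;> linarith
      have h4 := mul_le_mul_of_nonneg_left h3 (abs_nonneg (p - s))
      linarith

/-! ### Total positivity -/

/-- Division-free form of "a / b is nonincreasing if each step is". Positivity of `b` must propagate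
so that the intermediate factor `b m` can be cancelled. -/
lemma cross_mul_le_of_succ {a b : ℕ → ℝ} (ha : ∀ n, 0 ≤ a n) (hb : ∀ n, 0 ≤ b n)
    (hpos : ∀ n, 0 < b n → 0 < b (n + 1)) (h : ∀ n, a (n + 1) * b n ≤ b (n + 1) * a n)
    {n m : ℕ} (hnm : n ≤ m) : a m * b n ≤ b m * a n := by
  rcases (hb n).eq_or_lt with h0 | h0
  · rw [← h0, mul_zero]
    exact mul_nonneg (hb m) (ha n)
  have key : 0 < b m ∧ a m * b n ≤ b m * a n := by
    induction m, hnm using Nat.le_induction with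
    | base => exact ⟨h0, (mul_comm _ _).le⟩
    | succ m _ ih =>
      refine ⟨hpos m ih.1, le_of_mul_le_mul_right ?_ ih.1⟩
      calc a (m + 1) * b n * b m = (a (m + 1) * b m) * b n := by ring
        _ ≤ (b (m + 1) * a m) * b n := mul_le_mul_of_nonneg_right (h m) (hb n)
        _ = b (m + 1) * (a m * b n) := by ring
        _ ≤ b (m + 1) * (b m * a n) := mul_le_mul_of_nonneg_left ih.2 (hb _)
        _ = b (m + 1) * a n * b m := by ring
  exact key.2

lemma pow_mul_cross_le {p s : ℝ} (hp0 : 0 ≤ p) (hps : p ≤ s) (hs1 : s ≤ 1) (a b : ℕ) :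
    p ^ a * (1 - s) ^ b ≤ s ^ a * (1 - p) ^ b :=
  mul_le_mul (pow_le_pow_left₀ hp0 hps a)
    (pow_le_pow_left₀ (by linarith) (by linarith) b)
    (pow_nonneg (by linarith) b) (pow_nonneg (by linarith) a)

/-- After `binomCDF_succ` the common product cancels, leaving the mass at `f` against the masses at
i ≤ f. For f = i + d, removing common factors reduces each term to p^(d+1) (1-s)^d ≤ s^(d+1)
(1-p)^d. -/
lemma binomCDF_step {p s : ℝ} (hp0 : 0 ≤ p) (hps : p ≤ s) (hs1 : s ≤ 1) (f n : ℕ) :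
    binomCDF f (n + 1) s * binomCDF f n p ≤ binomCDF f (n + 1) p * binomCDF f n s := by
  rw [binomCDF_succ, binomCDF_succ]
  suffices h : p * ((n.choose f : ℝ) * p ^ f * (1 - p) ^ (n - f)) * binomCDF f n s
      ≤ s * ((n.choose f : ℝ) * s ^ f * (1 - s) ^ (n - f)) * binomCDF f n p by nlinarith
  have hp1 : 0 ≤ 1 - p := by linarith
  have hs0 : 0 ≤ s := hp0.trans hps
  have hs1' : 0 ≤ 1 - s := by linarith
  rcases Nat.lt_or_ge n f with hnf | hnf
  · rw [Nat.choose_eq_zero_of_lt hnf]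
    simp
  unfold binomCDF
  rw [Finset.mul_sum, Finset.mul_sum]
  refine Finset.sum_le_sum fun i hi => ?_
  have hi' : i ≤ f := Nat.lt_succ_iff.1 (Finset.mem_range.1 hi)
  obtain ⟨d, rfl⟩ := Nat.exists_eq_add_of_le hi'
  obtain ⟨g, rfl⟩ := Nat.exists_eq_add_of_le hnf
  have e1 : i + d + g - (i + d) = g := by omega
  have e2 : i + d + g - i = g + d := by omega
  rw [e1, e2]
  have := pow_mul_cross_le hp0 hps hs1 (d + 1) d
  calc _ = (((i + d + g).choose (i + d) : ℝ) * ((i + d + g).choose i : ℝ) * p ^ i * s ^ i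
          * (1 - p) ^ g * (1 - s) ^ g) * (p ^ (d + 1) * (1 - s) ^ d) := by ring
    _ ≤ (((i + d + g).choose (i + d) : ℝ) * ((i + d + g).choose i : ℝ) * p ^ i * s ^ i
          * (1 - p) ^ g * (1 - s) ^ g) * (s ^ (d + 1) * (1 - p) ^ d) :=
        mul_le_mul_of_nonneg_left this (by positivity)
    _ = _ := by ring

/-- The same cancellation against the masses at i = f + d + 1; the extra factor now sits on the
failure side. -/
lemma one_sub_binomCDF_step {p s : ℝ} (hp0 : 0 ≤ p) (hps : p ≤ s) (hs1 : s ≤ 1) (f n : ℕ) :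
    (1 - binomCDF f (n + 1) s) * (1 - binomCDF f n p)
      ≤ (1 - binomCDF f (n + 1) p) * (1 - binomCDF f n s) := by
  rw [binomCDF_succ, binomCDF_succ]
  suffices h : s * ((n.choose f : ℝ) * s ^ f * (1 - s) ^ (n - f)) * (1 - binomCDF f n p)
      ≤ p * ((n.choose f : ℝ) * p ^ f * (1 - p) ^ (n - f)) * (1 - binomCDF f n s) by nlinarith
  have hp1 : 0 ≤ 1 - p := by linarith
  have hs0 : 0 ≤ s := hp0.trans hps
  have hs1' : 0 ≤ 1 - s := by linarith
  rw [one_sub_binomCDF, one_sub_binomCDF, Finset.mul_sum, Finset.mul_sum]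
  refine Finset.sum_le_sum fun i hi => ?_
  simp only [Finset.mem_filter, Finset.mem_range, not_le] at hi
  obtain ⟨d, rfl⟩ := Nat.exists_eq_add_of_lt hi.2
  obtain ⟨g, rfl⟩ := Nat.exists_eq_add_of_le (Nat.lt_succ_iff.1 hi.1)
  have e1 : f + d + 1 + g - f = g + (d + 1) := by omega
  have e2 : f + d + 1 + g - (f + d + 1) = g := by omega
  rw [e1, e2]
  have := pow_mul_cross_le hp0 hps hs1 d (d + 1)
  calc _ = (((f + d + 1 + g).choose f : ℝ) * ((f + d + 1 + g).choose (f + d + 1) : ℝ)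
          * p ^ (f + 1) * s ^ (f + 1) * (1 - p) ^ g * (1 - s) ^ g)
          * (p ^ d * (1 - s) ^ (d + 1)) := by ring
    _ ≤ (((f + d + 1 + g).choose f : ℝ) * ((f + d + 1 + g).choose (f + d + 1) : ℝ)
          * p ^ (f + 1) * s ^ (f + 1) * (1 - p) ^ g * (1 - s) ^ g)
          * (s ^ d * (1 - p) ^ (d + 1)) :=
        mul_le_mul_of_nonneg_left this (by positivity)
    _ = _ := by ring

lemma binomCDF_cross {p s : ℝ} (hp0 : 0 ≤ p) (hps : p ≤ s) (hs1 : s ≤ 1) (f : ℕ) {n m : ℕ}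
    (hnm : n ≤ m) : binomCDF f m s * binomCDF f n p ≤ binomCDF f m p * binomCDF f n s := by
  have hs0 : 0 ≤ s := hp0.trans hps
  have hp1 : p ≤ 1 := hps.trans hs1
  -- At p = 1 positivity does not propagate in the number of trials, but then s = 1 and both sides
  -- coincide.
  rcases hp1.eq_or_lt with h | h
  · rw [le_antisymm hps (h ▸ hs1)]
  · exact cross_mul_le_of_succ (a := fun n => binomCDF f n s) (b := fun n => binomCDF f n p)
      (fun _ => binomCDF_nonneg hs0 hs1) (fun _ => binomCDF_nonneg hp0 hp1)
      (fun _ _ => binomCDF_pos hp0 h) (binomCDF_step hp0 hps hs1 f) hnm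

lemma one_sub_binomCDF_cross {p s : ℝ} (hp0 : 0 ≤ p) (hps : p ≤ s) (hs1 : s ≤ 1) (f : ℕ)
    {n m : ℕ} (hnm : n ≤ m) :
    (1 - binomCDF f m s) * (1 - binomCDF f n p)
      ≤ (1 - binomCDF f m p) * (1 - binomCDF f n s) := by
  have hs0 : 0 ≤ s := hp0.trans hps
  have hp1 : p ≤ 1 := hps.trans hs1
  refine cross_mul_le_of_succ (a := fun n => 1 - binomCDF f n s)
    (b := fun n => 1 - binomCDF f n p)
    (fun _ => sub_nonneg.2 (binomCDF_le_one hs0 hs1))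
    (fun _ => sub_nonneg.2 (binomCDF_le_one hp0 hp1))
    (fun n hn => ?_) (one_sub_binomCDF_step hp0 hps hs1 f) hnm
  have := binomCDF_succ f n p
  have h2 := mul_nonneg hp0 (binom_term_nonneg (n := n) hp0 hp1 f)
  linarith

/-! ### The functions `psi` -/

lemma continuous_psi (q : ℝ) (N k : ℕ) : Continuous (psi q N k) := by
  unfold psi bernsteinTail
  fun_prop

/-- Count failures instead of successes: the threshold N - r is then free of `k`, which enters only
through the number of trials. This is the form in which the cross inequalities apply. -/
lemma bernsteinTail_eq_binomCDF {r N k : ℕ} (hk : k ≤ N) (hr : r ≤ N) (t : ℝ) :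
    bernsteinTail ((r : ℤ) - k) (N - k) t = binomCDF (N - r) (N - k) (1 - t) := by
  rw [binomCDF_eq_filter, bernsteinTail]
  refine Finset.sum_nbij' (fun j => N - k - j) (fun j => N - k - j) ?_ ?_ ?_ ?_ ?_
  · intro j hj
    simp only [Finset.mem_filter, Finset.mem_range] at hj ⊢
    omega
  · intro j hj
    simp only [Finset.mem_filter, Finset.mem_range] at hj ⊢
    omega
  · intro j hj
    simp only [Finset.mem_filter, Finset.mem_range] at hj ⊢
    omega
  · intro j hj
    simp only [Finset.mem_filter, Finset.mem_range] at hj ⊢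
    omega
  · intro j hj
    simp only [Finset.mem_filter, Finset.mem_range] at hj
    have hj' : j ≤ N - k := by omega
    rw [Nat.choose_symm hj', Nat.sub_sub_self hj', sub_sub_cancel]
    ring

section
variable {q : ℝ}

lemma ceil_mul_le (hq1 : q ≤ 1) (N : ℕ) : ⌈q * (N : ℝ)⌉₊ ≤ N :=
  Nat.ceil_le.2 (mul_le_of_le_one_left (Nat.cast_nonneg N) hq1)

lemma intCeil_mul (hq0 : 0 ≤ q) (N : ℕ) : ⌈q * (N : ℝ)⌉ = ((⌈q * (N : ℝ)⌉₊ : ℕ) : ℤ) :=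
  (Int.natCast_ceil_eq_ceil (by positivity)).symm

lemma psi_eq (hq0 : 0 ≤ q) (hq1 : q ≤ 1) {N k : ℕ} (hk : k ≤ N) (t : ℝ) :
    psi q N k t = (1 - binomCDF (N - ⌈q * (N : ℝ)⌉₊) (N - k) (1 - t)) * (t - q)
      + max (q - t) 0 := by
  rw [psi, intCeil_mul hq0, bernsteinTail_eq_binomCDF hk (ceil_mul_le hq1 N)]

lemma psi_of_le (hq0 : 0 ≤ q) (hq1 : q ≤ 1) {N k : ℕ} (hk : k ≤ N) {t : ℝ} (ht : t ≤ q) :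
    psi q N k t = binomCDF (N - ⌈q * (N : ℝ)⌉₊) (N - k) (1 - t) * (q - t) := by
  rw [psi_eq hq0 hq1 hk, max_eq_left (by linarith)]
  ring

lemma psi_of_ge (hq0 : 0 ≤ q) (hq1 : q ≤ 1) {N k : ℕ} (hk : k ≤ N) {t : ℝ} (ht : q ≤ t) :
    psi q N k t = (1 - binomCDF (N - ⌈q * (N : ℝ)⌉₊) (N - k) (1 - t)) * (t - q) := by
  rw [psi_eq hq0 hq1 hk, max_eq_right (by linarith)]
  ring

lemma psi_nonneg (hq0 : 0 ≤ q) (hq1 : q ≤ 1) {N k : ℕ} (hk : k ≤ N) {t : ℝ} (ht0 : 0 ≤ t)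
    (ht1 : t ≤ 1) : 0 ≤ psi q N k t := by
  rcases le_total t q with h | h
  · rw [psi_of_le hq0 hq1 hk h]
    exact mul_nonneg (binomCDF_nonneg (by linarith) (by linarith)) (by linarith)
  · rw [psi_of_ge hq0 hq1 hk h]
    exact mul_nonneg (sub_nonneg.2 (binomCDF_le_one (by linarith) (by linarith))) (by linarith)

lemma psi_le_one (hq0 : 0 ≤ q) (hq1 : q ≤ 1) {N k : ℕ} (hk : k ≤ N) {t : ℝ} (ht0 : 0 ≤ t)
    (ht1 : t ≤ 1) : psi q N k t ≤ 1 := by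
  have h0 : 0 ≤ binomCDF (N - ⌈q * (N : ℝ)⌉₊) (N - k) (1 - t) :=
    binomCDF_nonneg (by linarith) (by linarith)
  have h1 : binomCDF (N - ⌈q * (N : ℝ)⌉₊) (N - k) (1 - t) ≤ 1 :=
    binomCDF_le_one (by linarith) (by linarith)
  rcases le_total t q with h | h
  · rw [psi_of_le hq0 hq1 hk h]
    exact mul_le_one₀ h1 (by linarith) (by linarith)
  · rw [psi_of_ge hq0 hq1 hk h]
    exact mul_le_one₀ (by linarith) (by linarith) (by linarith)

lemma psi_cross_low (hq0 : 0 ≤ q) (hq1 : q ≤ 1) {N k l : ℕ} (hkl : k ≤ l) (hl : l ≤ N)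
    {s t : ℝ} (hs0 : 0 ≤ s) (hst : s ≤ t) (ht : t ≤ q) :
    psi q N k s * psi q N l t ≤ psi q N k t * psi q N l s := by
  rw [psi_of_le hq0 hq1 (hkl.trans hl) ht, psi_of_le hq0 hq1 (hkl.trans hl) (hst.trans ht),
    psi_of_le hq0 hq1 hl ht, psi_of_le hq0 hq1 hl (hst.trans ht)]
  have := binomCDF_cross (p := 1 - t) (s := 1 - s) (by linarith) (by linarith) (by linarith)
    (N - ⌈q * (N : ℝ)⌉₊) (Nat.sub_le_sub_left hkl N)
  have h2 := mul_le_mul_of_nonneg_right this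
    (mul_nonneg (by linarith) (by linarith) : 0 ≤ (q - s) * (q - t))
  linarith

lemma psi_cross_high (hq0 : 0 ≤ q) (hq1 : q ≤ 1) {N k l : ℕ} (hkl : k ≤ l) (hl : l ≤ N)
    {s t : ℝ} (hs : q ≤ s) (hst : s ≤ t) (ht : t ≤ 1) :
    psi q N k s * psi q N l t ≤ psi q N k t * psi q N l s := by
  rw [psi_of_ge hq0 hq1 (hkl.trans hl) hs, psi_of_ge hq0 hq1 (hkl.trans hl) (hs.trans hst),
    psi_of_ge hq0 hq1 hl hs, psi_of_ge hq0 hq1 hl (hs.trans hst)]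
  have := one_sub_binomCDF_cross (p := 1 - t) (s := 1 - s) (by linarith) (by linarith)
    (by linarith) (N - ⌈q * (N : ℝ)⌉₊) (Nat.sub_le_sub_left hkl N)
  have h2 := mul_le_mul_of_nonneg_right this
    (mul_nonneg (by linarith) (by linarith) : 0 ≤ (s - q) * (t - q))
  linarith

/-- The constant is N for the binomial factor, 1 for the factor t - q and 1 for the positive part.
-/
lemma psi_le_add (hq0 : 0 ≤ q) (hq1 : q ≤ 1) {N k : ℕ} (hk : k ≤ N) {s t : ℝ}
    (hs0 : 0 ≤ s) (hs1 : s ≤ 1) (ht0 : 0 ≤ t) (ht1 : t ≤ 1) :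
    psi q N k s ≤ psi q N k t + (N + 2) * |s - t| := by
  rw [psi_eq hq0 hq1 hk, psi_eq hq0 hq1 hk]
  set f := N - ⌈q * (N : ℝ)⌉₊
  have h := abs_binomCDF_sub_le (N - k) (p := 1 - s) (s := 1 - t) (by linarith) (by linarith)
    (by linarith) (by linarith) f
  have e : 1 - s - (1 - t) = -(s - t) := by ring
  rw [e, abs_neg] at h
  have hN : ((N - k : ℕ) : ℝ) ≤ N := by exact_mod_cast Nat.sub_le N k
  have h' := h.trans (mul_le_mul_of_nonneg_right hN (abs_nonneg (s - t)))
  set a := binomCDF f (N - k) (1 - s)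
  set b := binomCDF f (N - k) (1 - t)
  have ha0 : 0 ≤ a := binomCDF_nonneg (by linarith) (by linarith)
  have ha1 : a ≤ 1 := binomCDF_le_one (by linarith) (by linarith)
  have hmax : max (q - s) 0 ≤ max (q - t) 0 + |s - t| := by
    refine max_le ?_ (by positivity)
    have h1 := le_max_left (q - t) 0
    have h2 := neg_abs_le (s - t)
    linarith
  have h1 : (b - a) * (t - q) ≤ N * |s - t| := by
    calc (b - a) * (t - q) ≤ |(b - a) * (t - q)| := le_abs_self _
      _ = |a - b| * |t - q| := by rw [abs_mul, abs_sub_comm]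
      _ ≤ |a - b| * 1 := by
        refine mul_le_mul_of_nonneg_left ?_ (abs_nonneg _)
        rw [abs_le]; constructor <;> linarith
      _ ≤ N * |s - t| := by linarith
  have h2 : (1 - a) * (s - t) ≤ |s - t| := by
    calc (1 - a) * (s - t) ≤ (1 - a) * |s - t| :=
          mul_le_mul_of_nonneg_left (le_abs_self _) (by linarith)
      _ ≤ 1 * |s - t| := mul_le_mul_of_nonneg_right (by linarith) (abs_nonneg _)
      _ = |s - t| := one_mul _
  nlinarith

end

/-! ### Regret in terms of the distribution function -/

/-- Distribution function of a demand distribution. -/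
noncomputable def demandCDF (F : DemandDist) (u : ℝ) : ℝ :=
  (F : Measure (Set.Icc (0 : ℝ) 1)).real {D | (D : ℝ) ≤ u}

section
variable (F : DemandDist)

lemma demandCDF_mono : Monotone (demandCDF F) := fun _ _ h =>
  measureReal_mono fun _ hD => le_trans hD h

lemma demandCDF_nonneg (u : ℝ) : 0 ≤ demandCDF F u := measureReal_nonneg

lemma demandCDF_le_one (u : ℝ) : demandCDF F u ≤ 1 := measureReal_le_one

lemma demandCDF_one : demandCDF F 1 = 1 := by
  have : {D : Set.Icc (0 : ℝ) 1 | (D : ℝ) ≤ 1} = Set.univ := Set.eq_univ_of_forall fun D => D.2.2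
  rw [demandCDF, this, probReal_univ]

lemma measurableSet_demand_le (u : ℝ) : MeasurableSet {D : Set.Icc (0 : ℝ) 1 | (D : ℝ) ≤ u} :=
  measurable_subtype_coe measurableSet_Iic

lemma intervalIntegrable_demandCDF (a b : ℝ) :
    IntervalIntegrable (demandCDF F) volume a b :=
  (demandCDF_mono F).intervalIntegrable

end

/-- Fubini on the region u < X(ω). It serves with g = 1 for E[min(a, D)] and with g = F - q for the
random order quantity. -/
lemma integral_intervalIntegral_eq {Ω : Type*} [MeasurableSpace Ω] (P : Measure Ω)
    [IsProbabilityMeasure P] {X : Ω → ℝ} (hX : Measurable X) (h0 : ∀ ω, 0 ≤ X ω)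
    (h1 : ∀ ω, X ω ≤ 1) {g : ℝ → ℝ} (hg : IntervalIntegrable g volume 0 1) :
    ∫ ω, (∫ u in (0 : ℝ)..X ω, g u) ∂P = ∫ u in (0 : ℝ)..1, P.real {ω | u < X ω} * g u := by
  have hg' : Integrable g (volume.restrict (Set.Ioc 0 1)) :=
    (intervalIntegrable_iff_integrableOn_Ioc_of_le zero_le_one).1 hg
  have e : ∀ ω, (∫ u in (0 : ℝ)..X ω, g u)
      = ∫ u in Set.Ioc (0 : ℝ) 1, {p : Ω × ℝ | p.2 < X p.1}.indicator (fun p => g p.2) (ω, u) := by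
    intro ω
    rw [intervalIntegral.integral_of_le (h0 ω), integral_Ioc_eq_integral_Ioo]
    have : (fun u => {p : Ω × ℝ | p.2 < X p.1}.indicator (fun p => g p.2) (ω, u))
        = (Set.Iio (X ω)).indicator g := by
      ext u
      simp [Set.indicator]
    rw [this, setIntegral_indicator measurableSet_Iio]
    congr 2
    ext u
    simp only [Set.mem_Ioo, Set.mem_inter_iff, Set.mem_Ioc, Set.mem_Iio]
    have := h1 ω
    constructor
    · rintro ⟨a, b⟩
      exact ⟨⟨a, by linarith⟩, b⟩
    · rintro ⟨⟨a, _⟩, b⟩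
      exact ⟨a, b⟩
  have hm : MeasurableSet {p : Ω × ℝ | p.2 < X p.1} :=
    measurableSet_lt measurable_snd (hX.comp measurable_fst)
  simp_rw [e]
  rw [integral_integral_swap, intervalIntegral.integral_of_le zero_le_one]
  · refine integral_congr_ae (Filter.Eventually.of_forall fun u => ?_)
    have : (fun ω => {p : Ω × ℝ | p.2 < X p.1}.indicator (fun p => g p.2) (ω, u))
        = {ω | u < X ω}.indicator (fun _ => g u) := by
      ext ω
      simp [Set.indicator]
    simp only [this]
    rw [integral_indicator_const _ (measurableSet_lt measurable_const hX), smul_eq_mul]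
  · exact (hg'.comp_snd P).indicator hm

lemma cost_eq (q a D : ℝ) : cost q a D = a - min a D - q * a + q * D := by
  unfold cost
  rcases le_total a D with h | h
  · rw [max_eq_right (by linarith), max_eq_left (by linarith), min_eq_left h]; ring
  · rw [max_eq_left (by linarith), max_eq_right (by linarith), min_eq_right h]; ring

lemma integral_min (F : DemandDist) {a : ℝ} (ha : a ∈ Set.Icc (0 : ℝ) 1) :
    ∫ D, min a (D : ℝ) ∂(F : Measure (Set.Icc (0 : ℝ) 1))
      = ∫ u in (0 : ℝ)..a, (1 - demandCDF F u) := by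
  have h := integral_intervalIntegral_eq (F : Measure (Set.Icc (0 : ℝ) 1))
    (X := fun D => min a (D : ℝ)) (measurable_const.min measurable_subtype_coe)
    (fun D => le_min ha.1 D.2.1) (fun D => (min_le_left _ _).trans ha.2)
    (g := fun _ => 1) intervalIntegrable_const
  simp only [intervalIntegral.integral_const, sub_zero, smul_eq_mul, mul_one] at h
  rw [h, ← intervalIntegral.integral_add_adjacent_intervals (b := a)]
  · have h1 : ∫ u in a..1, (F : Measure (Set.Icc (0 : ℝ) 1)).real {D | u < min a (D : ℝ)} = 0 := by
      rw [intervalIntegral.integral_congr (g := fun _ => (0 : ℝ)), intervalIntegral.integral_zero]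
      intro u hu
      rw [Set.uIcc_of_le ha.2] at hu
      have : {D : Set.Icc (0 : ℝ) 1 | u < min a (D : ℝ)} = ∅ := by
        ext D
        simp only [lt_min_iff, Set.mem_ofPred_eq, Set.mem_empty_iff_false, iff_false, not_and]
        intro h
        linarith [hu.1]
      simp only [this, measureReal_empty]
    rw [h1, add_zero]
    refine intervalIntegral.integral_congr_ae ?_
    have hne : ∀ᵐ u : ℝ, u ≠ a := by simp [ae_iff]
    filter_upwards [hne] with u hua hu
    rw [Set.uIoc_of_le ha.1] at hu
    have hlt : u < a := lt_of_le_of_ne hu.2 hua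
    have : {D : Set.Icc (0 : ℝ) 1 | u < min a (D : ℝ)} = {D : Set.Icc (0 : ℝ) 1 | (D : ℝ) ≤ u}ᶜ := by
      ext D
      simp [hlt]
    rw [this, probReal_compl_eq_one_sub (measurableSet_demand_le u), demandCDF]
  all_goals
    refine AntitoneOn.intervalIntegrable fun u _ v _ huv => ?_
    exact measureReal_mono fun D hD => lt_of_le_of_lt huv hD

lemma expectedCost_eq (q : ℝ) (F : DemandDist) {a : ℝ} (ha : a ∈ Set.Icc (0 : ℝ) 1) :
    expectedCost q a F = (∫ u in (0 : ℝ)..a, (demandCDF F u - q))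
      + q * ∫ D, (D : ℝ) ∂(F : Measure (Set.Icc (0 : ℝ) 1)) := by
  have hD : Integrable (fun D : Set.Icc (0 : ℝ) 1 => (D : ℝ))
      (F : Measure (Set.Icc (0 : ℝ) 1)) :=
    Integrable.of_bound measurable_subtype_coe.aestronglyMeasurable 1
      (Filter.Eventually.of_forall fun D => by
        rw [Real.norm_eq_abs, abs_of_nonneg D.2.1]; exact D.2.2)
  have hm : Integrable (fun D : Set.Icc (0 : ℝ) 1 => min a (D : ℝ))
      (F : Measure (Set.Icc (0 : ℝ) 1)) := (integrable_const a).inf hD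
  have h1 : Integrable (fun D : Set.Icc (0 : ℝ) 1 => a - min a (D : ℝ))
      (F : Measure (Set.Icc (0 : ℝ) 1)) := (integrable_const a).sub hm
  have h2 : Integrable (fun D : Set.Icc (0 : ℝ) 1 => a - min a (D : ℝ) - q * a)
      (F : Measure (Set.Icc (0 : ℝ) 1)) := h1.sub (integrable_const _)
  unfold expectedCost
  simp_rw [cost_eq]
  rw [integral_add h2 (hD.const_mul q), integral_sub h1 (integrable_const _),
    integral_sub (integrable_const _) hm, integral_min F ha,
    intervalIntegral.integral_sub intervalIntegrable_const (intervalIntegrable_demandCDF F _ _),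
    intervalIntegral.integral_sub (intervalIntegrable_demandCDF F _ _) intervalIntegrable_const]
  simp only [integral_const, probReal_univ, intervalIntegral.integral_const, smul_eq_mul,
    integral_const_mul]
  ring

lemma intervalIntegrable_shortfall (q : ℝ) (F : DemandDist) (a b : ℝ) :
    IntervalIntegrable (fun u => max (q - demandCDF F u) 0) volume a b :=
  Antitone.intervalIntegrable fun _ _ h =>
    max_le_max (sub_le_sub_left (demandCDF_mono F h) q) le_rfl

lemma regret_eq {q : ℝ} (hq1 : q ≤ 1) (F : DemandDist) {a : ℝ}
    (ha : a ∈ Set.Icc (0 : ℝ) 1) :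
    regret q a F = (∫ u in (0 : ℝ)..a, (demandCDF F u - q))
      + ∫ u in (0 : ℝ)..1, max (q - demandCDF F u) 0 := by
  set G := demandCDF F
  have hi : ∀ a b, IntervalIntegrable (fun u => G u - q) volume a b := fun a b =>
    (intervalIntegrable_demandCDF F a b).sub intervalIntegrable_const
  have hs := intervalIntegrable_shortfall q F
  have hopt : opt q F = - (∫ u in (0 : ℝ)..1, max (q - G u) 0)
      + q * ∫ D, (D : ℝ) ∂(F : Measure (Set.Icc (0 : ℝ) 1)) := by
    have hbdd : ∀ a : Set.Icc (0 : ℝ) 1, - (∫ u in (0 : ℝ)..1, max (q - G u) 0)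
        + q * ∫ D, (D : ℝ) ∂(F : Measure (Set.Icc (0 : ℝ) 1)) ≤ expectedCost q (a : ℝ) F := by
      intro a
      rw [expectedCost_eq q F a.2,
        ← intervalIntegral.integral_add_adjacent_intervals (hs 0 a) (hs a 1)]
      have h1 : 0 ≤ ∫ u in (a : ℝ)..1, max (q - G u) 0 :=
        intervalIntegral.integral_nonneg a.2.2 fun u _ => le_max_right _ _
      have h2 : ∫ u in (0 : ℝ)..a, - max (q - G u) 0 ≤ ∫ u in (0 : ℝ)..a, (G u - q) :=
        intervalIntegral.integral_mono_on a.2.1 (hs 0 a).neg (hi 0 a) fun u _ => by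
          have := le_max_left (q - G u) 0
          linarith
      rw [intervalIntegral.integral_neg] at h2
      change _ ≤ (∫ u in (0 : ℝ)..a, (G u - q)) + _
      linarith
    -- The `q`-quantile sInf A attains the lower bound: G - q is negative before it and nonnegative
    -- after it.
    set A : Set ℝ := {u | u ∈ Set.Icc (0 : ℝ) 1 ∧ q ≤ G u}
    have hA1 : (1 : ℝ) ∈ A := ⟨by simp, by rw [show G 1 = 1 from demandCDF_one F]; exact hq1⟩
    have hAb : BddBelow A := ⟨0, fun u hu => hu.1.1⟩
    have hc : sInf A ∈ Set.Icc (0 : ℝ) 1 :=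
      ⟨le_csInf ⟨1, hA1⟩ fun u hu => hu.1.1, csInf_le hAb hA1⟩
    refine le_antisymm ?_ (le_ciInf hbdd)
    refine (ciInf_le ⟨_, by rintro _ ⟨a, rfl⟩; exact hbdd a⟩ ⟨sInf A, hc⟩).trans_eq ?_
    change expectedCost q (sInf A) F = _
    rw [expectedCost_eq q F hc,
      ← intervalIntegral.integral_add_adjacent_intervals (hs 0 (sInf A)) (hs (sInf A) 1)]
    have h1 : ∫ u in (sInf A)..1, max (q - G u) 0 = 0 := by
      rw [intervalIntegral.integral_congr_ae (g := fun _ => (0 : ℝ)),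
        intervalIntegral.integral_zero]
      refine Filter.Eventually.of_forall fun u hu => ?_
      rw [Set.uIoc_of_le hc.2] at hu
      obtain ⟨v, hv, hvu⟩ := exists_lt_of_csInf_lt ⟨1, hA1⟩ hu.1
      have := demandCDF_mono F hvu.le
      exact max_eq_right (by linarith [hv.2])
    have h2 : ∫ u in (0 : ℝ)..sInf A, max (q - G u) 0
        = - ∫ u in (0 : ℝ)..sInf A, (G u - q) := by
      rw [← intervalIntegral.integral_neg]
      refine intervalIntegral.integral_congr_ae ?_
      have hne : ∀ᵐ u : ℝ, u ≠ sInf A := by simp [ae_iff]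
      filter_upwards [hne] with u hua hu
      rw [Set.uIoc_of_le hc.1] at hu
      have hlt : u < sInf A := lt_of_le_of_ne hu.2 hua
      have : G u < q := by
        by_contra hcon
        exact notMem_of_lt_csInf hlt hAb ⟨⟨hu.1.le, hu.2.trans hc.2⟩, not_lt.1 hcon⟩
      rw [max_eq_left (by linarith)]
      ring
    rw [h1, h2]
    simp [G]
  rw [regret, hopt, expectedCost_eq q F ha]
  ring

/-! ### Law of the pooled sales -/

open Classical in
/-- Number of labels whose level is at most `u`. -/
noncomputable def levelCount {ι : Type*} [Fintype ι] (y : ι → ℝ) (u : ℝ) : ℕ :=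
  (Finset.univ.filter fun s => y s ≤ u).card

lemma levelCount_mono {ι : Type*} [Fintype ι] (y : ι → ℝ) : Monotone (levelCount y) := by
  intro u v huv
  refine Finset.card_le_card fun s hs => ?_
  simp only [Finset.mem_filter, Finset.mem_univ, true_and] at hs ⊢
  exact hs.trans huv

lemma levelCount_le {ι : Type*} [Fintype ι] (y : ι → ℝ) (u : ℝ) :
    levelCount y u ≤ Fintype.card ι := Finset.card_le_univ _

lemma levelCount_comp_equiv {ι κ : Type*} [Fintype ι] [Fintype κ] (e : κ ≃ ι) (y : ι → ℝ)
    (u : ℝ) : levelCount (y ∘ e) u = levelCount y u := by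
  classical
  refine Finset.card_bij (fun s _ => e s) ?_ (fun _ _ _ _ h => e.injective h) ?_
  · intro s hs
    simpa using hs
  · intro s hs
    exact ⟨e.symm s, by simpa using hs, by simp⟩

section
variable {ι : Type*}

/-- Demands for which the labels in `A` with demand at most `u` are those in `T`. -/
def patternSet (A T : Finset ι) (u : ℝ) : Set (ι → Set.Icc (0 : ℝ) 1) :=
  {D | ∀ s ∈ A, ((D s : ℝ) ≤ u ↔ s ∈ T)}

open Classical in
lemma patternSet_eq_pi (A T : Finset ι) (u : ℝ) :
    patternSet A T u = Set.univ.pi fun s => if s ∈ A then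
      (if s ∈ T then {D : Set.Icc (0 : ℝ) 1 | (D : ℝ) ≤ u}
        else {D : Set.Icc (0 : ℝ) 1 | (D : ℝ) ≤ u}ᶜ) else Set.univ := by
  ext D
  simp only [patternSet, Set.mem_ofPred_eq, Set.mem_pi, Set.mem_univ, true_imp_iff]
  refine forall_congr' fun s => ?_
  by_cases hA : s ∈ A <;> by_cases hT : s ∈ T <;> simp [hA, hT]

variable [Fintype ι]

lemma measurableSet_patternSet (A T : Finset ι) (u : ℝ) :
    MeasurableSet (patternSet A T u) := by
  classical
  rw [patternSet_eq_pi]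
  refine MeasurableSet.univ_pi fun s => ?_
  split_ifs
  · exact measurableSet_demand_le u
  · exact (measurableSet_demand_le u).compl
  · exact MeasurableSet.univ

lemma measureReal_patternSet (F : DemandDist) {A T : Finset ι} (hT : T ⊆ A) (u : ℝ) :
    (Measure.pi fun _ : ι => (F : Measure (Set.Icc (0 : ℝ) 1))).real (patternSet A T u)
      = demandCDF F u ^ T.card * (1 - demandCDF F u) ^ (A.card - T.card) := by
  classical
  rw [patternSet_eq_pi, measureReal_def, Measure.pi_pi, ENNReal.toReal_prod]
  have : ∀ s, ((F : Measure (Set.Icc (0 : ℝ) 1)) (if s ∈ A then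
      (if s ∈ T then {D : Set.Icc (0 : ℝ) 1 | (D : ℝ) ≤ u}
        else {D : Set.Icc (0 : ℝ) 1 | (D : ℝ) ≤ u}ᶜ) else Set.univ)).toReal
      = if s ∈ A then (if s ∈ T then demandCDF F u else 1 - demandCDF F u) else 1 := by
    intro s
    split_ifs
    · rfl
    · exact probReal_compl_eq_one_sub (measurableSet_demand_le u)
    · simp
  simp_rw [this]
  rw [Finset.prod_ite_mem, Finset.univ_inter, Finset.prod_ite, Finset.prod_const,
    Finset.prod_const, Finset.filter_not, Finset.filter_mem_eq_inter,
    Finset.inter_eq_right.2 hT, Finset.card_sdiff_of_subset hT]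

-- A sale is at most `u` iff its level or its demand is. The event is split according to the set `T`
-- of labels with level above `u` whose demand is at most `u`.
open Classical in
lemma setOf_le_levelCount_min (r : ℕ) (y : ι → ℝ) (u : ℝ) :
    {D : ι → Set.Icc (0 : ℝ) 1 | r ≤ levelCount (fun s => min (D s : ℝ) (y s)) u}
      = ⋃ T ∈ ((Finset.univ.filter fun s => ¬ y s ≤ u).powerset.filter
          fun T => r ≤ levelCount y u + T.card),
        patternSet (Finset.univ.filter fun s => ¬ y s ≤ u) T u := by
  set A : Finset ι := Finset.univ.filter fun s => ¬ y s ≤ u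
  have key : ∀ D : ι → Set.Icc (0 : ℝ) 1, levelCount (fun s => min (D s : ℝ) (y s)) u
      = levelCount y u + (A.filter fun s => (D s : ℝ) ≤ u).card := by
    intro D
    unfold levelCount
    rw [← Finset.card_union_of_disjoint]
    · congr 1
      ext s
      simp only [A, Finset.mem_filter, Finset.mem_union, Finset.mem_univ, true_and, min_le_iff]
      tauto
    · rw [Finset.disjoint_left]
      intro s hs
      simp only [A, Finset.mem_filter, Finset.mem_univ, true_and] at hs ⊢
      tauto
  ext D
  simp only [Set.mem_ofPred_eq, Set.mem_iUnion, Finset.mem_filter, Finset.mem_powerset,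
    exists_prop, key D]
  constructor
  · intro h
    refine ⟨A.filter fun s => (D s : ℝ) ≤ u, ⟨Finset.filter_subset _ _, h⟩, fun s hs => ?_⟩
    simp [hs]
  · rintro ⟨T, ⟨hTA, hr⟩, hD⟩
    have : A.filter (fun s => (D s : ℝ) ≤ u) = T := by
      ext s
      rw [Finset.mem_filter]
      exact ⟨fun h => (hD s h.1).1 h.2, fun h => ⟨hTA h, (hD s (hTA h)).2 h⟩⟩
    rwa [this]

lemma measurableSet_le_levelCount_min (r : ℕ) (y : ι → ℝ) (u : ℝ) :
    MeasurableSet {D : ι → Set.Icc (0 : ℝ) 1 |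
      r ≤ levelCount (fun s => min (D s : ℝ) (y s)) u} := by
  classical
  rw [setOf_le_levelCount_min]
  exact Finset.measurableSet_biUnion _ fun T _ => measurableSet_patternSet _ T u

lemma measureReal_le_levelCount_min (F : DemandDist) (r : ℕ) (y : ι → ℝ) (u : ℝ) :
    (Measure.pi fun _ : ι => (F : Measure (Set.Icc (0 : ℝ) 1))).real
        {D | r ≤ levelCount (fun s => min (D s : ℝ) (y s)) u}
      = bernsteinTail ((r : ℤ) - levelCount y u) (Fintype.card ι - levelCount y u)
          (demandCDF F u) := by
  classical
  have hcard : (Finset.univ.filter fun s => ¬ y s ≤ u).card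
      = Fintype.card ι - levelCount y u := by
    rw [Finset.filter_not, Finset.card_sdiff_of_subset (Finset.filter_subset _ _),
      Finset.card_univ, levelCount]
  rw [setOf_le_levelCount_min, measureReal_biUnion_finset]
  -- The probability of a pattern depends only on the size of `T`; grouping by size produces the
  -- binomial coefficients.
  · rw [Finset.sum_congr rfl fun T hT => measureReal_patternSet F
      (Finset.mem_powerset.1 (Finset.mem_filter.1 hT).1) u, Finset.sum_filter,
      Finset.sum_powerset_apply_card (fun j => if r ≤ levelCount y u + j then
        demandCDF F u ^ j * (1 - demandCDF F u) ^ ((Finset.univ.filter fun s => ¬ y s ≤ u).card - j)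
        else 0), hcard, bernsteinTail, Finset.sum_filter]
    refine Finset.sum_congr rfl fun j _ => ?_
    have : ((r : ℤ) - levelCount y u ≤ j) ↔ r ≤ levelCount y u + j := by omega
    simp only [this, nsmul_eq_mul]
    split_ifs
    · ring
    · simp
  · intro T hT T' hT' hne
    rw [Function.onFun, Set.disjoint_left]
    intro D hD hD'
    apply hne
    rw [Finset.mem_coe, Finset.mem_filter, Finset.mem_powerset] at hT hT'
    ext s
    exact ⟨fun h => (hD' s (hT.1 h)).1 ((hD s (hT.1 h)).2 h),
      fun h => (hD s (hT'.1 h)).1 ((hD' s (hT'.1 h)).2 h)⟩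
  · exact fun T _ => measurableSet_patternSet _ T u

end

/-! ### Expected regret of BSAA -/

section
variable {q : ℝ} {K : ℕ} {n : Fin K → ℕ}

lemma empiricalCDF_eq (S : SampleIdx n → ℝ) (u : ℝ) :
    empiricalCDF S u = (levelCount S u : ℝ) / (Fintype.card (SampleIdx n) : ℝ) := rfl

lemma levelCount_one_of_le {ι : Type*} [Fintype ι] {S : ι → ℝ} {u : ℝ} (h : ∀ s, S s ≤ u) :
    levelCount S u = Fintype.card ι := by
  unfold levelCount
  rw [Finset.filter_true_of_mem fun s _ => h s, Finset.card_univ]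

lemma bsaa_mem (hq1 : q ≤ 1) (hN : 0 < Fintype.card (SampleIdx n)) (x : Fin K → ℝ)
    (I : SampleIdx n → ℝ × Bool) (hI : ∀ s, (I s).1 ≤ 1) :
    bsaa q n x I ∈ Set.Icc (0 : ℝ) 1 := by
  have h1 : (1 : ℝ) ∈ {u : ℝ | u ∈ Set.Icc (0 : ℝ) 1 ∧ q ≤ empiricalCDF (fun s => (I s).1) u} := by
    refine ⟨by simp, ?_⟩
    rw [empiricalCDF_eq, levelCount_one_of_le hI, div_self (by positivity)]
    exact hq1
  exact ⟨le_csInf ⟨1, h1⟩ fun u hu => hu.1.1, csInf_le ⟨0, fun u hu => hu.1.1⟩ h1⟩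

/-- The infimum is attained: if the count at `u` is too small, it stays constant up to the smallest
sale above `u`, so the order is at least that sale. -/
lemma bsaa_le_iff (hq1 : q ≤ 1) (hN : 0 < Fintype.card (SampleIdx n)) (x : Fin K → ℝ)
    (I : SampleIdx n → ℝ × Bool) (hI : ∀ s, (I s).1 ≤ 1) {u : ℝ} (hu : u ∈ Set.Icc (0 : ℝ) 1) :
    bsaa q n x I ≤ u ↔
      ⌈q * (Fintype.card (SampleIdx n) : ℝ)⌉₊ ≤ levelCount (fun s => (I s).1) u := by
  classical
  set S : SampleIdx n → ℝ := fun s => (I s).1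
  have hN' : (0 : ℝ) < Fintype.card (SampleIdx n) := by exact_mod_cast hN
  have hmem : ∀ v, q ≤ empiricalCDF S v ↔
      ⌈q * (Fintype.card (SampleIdx n) : ℝ)⌉₊ ≤ levelCount S v := by
    intro v
    rw [empiricalCDF_eq, le_div_iff₀ hN', Nat.ceil_le]
  constructor
  · intro h
    by_contra hcon
    set T : Finset (SampleIdx n) := Finset.univ.filter fun s => u < S s
    have hT : T.Nonempty := by
      by_contra hT
      rw [Finset.not_nonempty_iff_eq_empty, Finset.filter_eq_empty_iff] at hT
      apply hcon
      rw [levelCount_one_of_le fun s => not_lt.1 (hT (Finset.mem_univ s))]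
      exact ceil_mul_le hq1 _
    obtain ⟨s, hs, hmin⟩ := T.exists_min_image S hT
    have hus : u < S s := (Finset.mem_filter.1 hs).2
    have hle : S s ≤ bsaa q n x I := by
      refine le_csInf ⟨1, by simp, ?_⟩ fun v hv => ?_
      · rw [hmem, levelCount_one_of_le hI]
        exact ceil_mul_le hq1 _
      · by_contra hlt
        apply hcon
        refine ((hmem v).1 hv.2).trans (Finset.card_le_card fun s' hs' => ?_)
        simp only [Finset.mem_filter, Finset.mem_univ, true_and] at hs' ⊢
        by_contra hs''
        have := hmin s' (Finset.mem_filter.2 ⟨Finset.mem_univ _, not_le.1 hs''⟩)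
        linarith
    linarith
  · intro h
    exact csInf_le ⟨0, fun v hv => hv.1.1⟩ ⟨hu, (hmem u).2 h⟩

lemma info_fst_le_one (x : Fin K → ℝ) (D : SampleIdx n → Set.Icc (0 : ℝ) 1) (s : SampleIdx n) :
    (info x D s).1 ≤ 1 := (min_le_left _ _).trans (D s).2.2

lemma setOf_bsaa_le (hq1 : q ≤ 1) (hN : 0 < Fintype.card (SampleIdx n)) (x : Fin K → ℝ)
    {u : ℝ} (hu : u ∈ Set.Icc (0 : ℝ) 1) :
    {D : SampleIdx n → Set.Icc (0 : ℝ) 1 | bsaa q n x (info x D) ≤ u}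
      = {D | ⌈q * (Fintype.card (SampleIdx n) : ℝ)⌉₊
          ≤ levelCount (fun s => min (D s : ℝ) (x s.1)) u} := by
  ext D
  exact bsaa_le_iff hq1 hN x _ (info_fst_le_one x D) hu

lemma measurable_bsaa (hq1 : q ≤ 1) (hN : 0 < Fintype.card (SampleIdx n)) (x : Fin K → ℝ) :
    Measurable fun D : SampleIdx n → Set.Icc (0 : ℝ) 1 => bsaa q n x (info x D) := by
  refine measurable_of_Iic fun u => ?_
  have hmem := fun D : SampleIdx n → Set.Icc (0 : ℝ) 1 =>
    bsaa_mem hq1 hN x _ (info_fst_le_one x D)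
  rcases lt_or_ge u 0 with h0 | h0
  · convert MeasurableSet.empty
    ext D
    simp only [Set.mem_preimage, Set.mem_Iic, Set.mem_empty_iff_false, iff_false, not_le]
    linarith [(hmem D).1]
  rcases lt_or_ge 1 u with h1 | h1
  · convert MeasurableSet.univ
    ext D
    simp only [Set.mem_preimage, Set.mem_Iic, Set.mem_univ, iff_true]
    linarith [(hmem D).2]
  · change MeasurableSet {D : SampleIdx n → Set.Icc (0 : ℝ) 1 | bsaa q n x (info x D) ≤ u}
    rw [setOf_bsaa_le hq1 hN x ⟨h0, h1⟩]
    exact measurableSet_le_levelCount_min _ _ u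

lemma intervalIntegrable_of_abs_le {f : ℝ → ℝ} (hf : Measurable f) {C : ℝ}
    (hC : ∀ u, |f u| ≤ C) (a b : ℝ) : IntervalIntegrable f volume a b := by
  constructor <;> exact Integrable.of_bound hf.aestronglyMeasurable C
    (Filter.Eventually.of_forall hC)

lemma expectedRegret_bsaa (hq0 : 0 ≤ q) (hq1 : q ≤ 1) (hN : 0 < Fintype.card (SampleIdx n))
    (x : Fin K → ℝ) (F : DemandDist) :
    expectedRegret q (bsaa q n) x F = ∫ u in (0 : ℝ)..1,
      psi q (Fintype.card (SampleIdx n)) (levelCount (fun s : SampleIdx n => x s.1) u)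
        (demandCDF F u) := by
  set P : Measure (SampleIdx n → Set.Icc (0 : ℝ) 1) :=
    Measure.pi fun _ : SampleIdx n => (F : Measure (Set.Icc (0 : ℝ) 1))
  set X : (SampleIdx n → Set.Icc (0 : ℝ) 1) → ℝ := fun D => bsaa q n x (info x D)
  have hX : Measurable X := measurable_bsaa hq1 hN x
  have hXm : ∀ D, X D ∈ Set.Icc (0 : ℝ) 1 := fun D => bsaa_mem hq1 hN x _ (info_fst_le_one x D)
  have hi : ∀ a b, IntervalIntegrable (fun u => demandCDF F u - q) volume a b := fun a b =>
    (intervalIntegrable_demandCDF F a b).sub intervalIntegrable_const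
  have habs : ∀ u, |demandCDF F u - q| ≤ 1 := fun u => by
    have h1 := demandCDF_nonneg F u
    have h2 := demandCDF_le_one F u
    rw [abs_le]; constructor <;> linarith
  have hprim : Integrable (fun D => ∫ u in (0 : ℝ)..X D, (demandCDF F u - q)) P := by
    refine Integrable.of_bound
      ((intervalIntegral.continuous_primitive hi 0).measurable.comp hX).aestronglyMeasurable 1
      (Filter.Eventually.of_forall fun D => ?_)
    refine (intervalIntegral.norm_integral_le_of_norm_le_const (C := 1)
      fun u _ => habs u).trans ?_
    rw [one_mul, sub_zero, abs_of_nonneg (hXm D).1]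
    exact (hXm D).2
  have e1 : expectedRegret q (bsaa q n) x F = ∫ D, ((∫ u in (0 : ℝ)..X D, (demandCDF F u - q))
      + ∫ u in (0 : ℝ)..1, max (q - demandCDF F u) 0) ∂P :=
    integral_congr_ae (Filter.Eventually.of_forall fun D => regret_eq hq1 F (hXm D))
  have hanti : Antitone fun u => P.real {D | u < X D} := fun u v huv =>
    measureReal_mono fun D hD => lt_of_le_of_lt huv hD
  rw [e1, integral_add hprim (integrable_const _), integral_const, probReal_univ, one_smul,
    integral_intervalIntegral_eq P hX (fun D => (hXm D).1) (fun D => (hXm D).2) (hi 0 1),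
    ← intervalIntegral.integral_add]
  · refine intervalIntegral.integral_congr fun u hu => ?_
    rw [Set.uIcc_of_le zero_le_one] at hu
    have hc : {D | u < X D} = {D | X D ≤ u}ᶜ := by
      ext D
      simp
    have hset : {D | X D ≤ u} = _ := setOf_bsaa_le hq1 hN x hu
    have hms : MeasurableSet {D | X D ≤ u} := hX measurableSet_Iic
    rw [hc, probReal_compl_eq_one_sub hms, hset, measureReal_le_levelCount_min,
      psi, intCeil_mul hq0]
  · refine intervalIntegrable_of_abs_le
      (hanti.measurable.mul ((demandCDF_mono F).measurable.sub_const q)) (C := 1) (fun u => ?_) 0 1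
    change |P.real _ * (demandCDF F u - q)| ≤ 1
    rw [abs_mul, abs_of_nonneg measureReal_nonneg]
    exact mul_le_one₀ measureReal_le_one (abs_nonneg _) (habs u)
  · exact intervalIntegrable_shortfall q F 0 1

end

/-! ### Nodes -/

section
variable {N : ℕ} {x : Fin N → ℝ}

lemma node_zero (x : Fin N → ℝ) : node x 0 = 0 := by simp [node]

lemma node_succ_of_lt (x : Fin N → ℝ) {j : ℕ} (hj : j < N) : node x (j + 1) = x ⟨j, hj⟩ := by
  simp [node, hj]

lemma node_last (x : Fin N → ℝ) : node x (N + 1) = 1 := by simp [node]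

lemma node_le_succ (hx : Monotone x) (h01 : ∀ i, x i ∈ Set.Icc (0 : ℝ) 1) {j : ℕ} (hj : j ≤ N) :
    node x j ≤ node x (j + 1) := by
  rcases j with _ | j
  · rw [node_zero]
    rcases Nat.eq_zero_or_pos N with rfl | hN
    · rw [node_last]; exact zero_le_one
    · rw [node_succ_of_lt x hN]; exact (h01 _).1
  · rw [node_succ_of_lt x hj]
    rcases (Nat.lt_or_ge (j + 1) N) with h | h
    · rw [node_succ_of_lt x h]
      exact hx (by simp [Fin.le_def])
    · obtain rfl : N = j + 1 := le_antisymm h hj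
      rw [node_last]
      exact (h01 _).2

lemma node_mono (hx : Monotone x) (h01 : ∀ i, x i ∈ Set.Icc (0 : ℝ) 1) {i j : ℕ} (hij : i ≤ j)
    (hj : j ≤ N + 1) : node x i ≤ node x j := by
  induction j, hij using Nat.le_induction with
  | base => exact le_rfl
  | succ j _ ih => exact (ih (by omega)).trans (node_le_succ hx h01 (by omega))

lemma node_mem (hx : Monotone x) (h01 : ∀ i, x i ∈ Set.Icc (0 : ℝ) 1) {j : ℕ} (hj : j ≤ N + 1) :
    node x j ∈ Set.Icc (0 : ℝ) 1 := by
  have h1 := node_mono hx h01 (Nat.zero_le j) hj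
  have h2 := node_mono hx h01 hj le_rfl
  rw [node_zero] at h1
  rw [node_last] at h2
  exact ⟨h1, h2⟩

lemma levelCount_eq (hx : Monotone x) (h01 : ∀ i, x i ∈ Set.Icc (0 : ℝ) 1) {k : ℕ} (hk : k ≤ N)
    {u : ℝ} (h1 : node x k ≤ u) (h2 : u < node x (k + 1)) : levelCount x u = k := by
  have : ∀ i : Fin N, x i ≤ u ↔ (i : ℕ) < k := by
    intro i
    have e : x i = node x (i + 1) := (node_succ_of_lt x i.2).symm
    rw [e]
    constructor
    · intro h
      by_contra hcon
      have := node_mono hx h01 (i := k + 1) (j := i + 1) (by omega) (by omega)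
      linarith
    · intro h
      exact (node_mono hx h01 (by omega) (by omega)).trans h1
  unfold levelCount
  simp_rw [this]
  rw [Fin.card_filter_val_lt, min_eq_right hk]

/-! ### Worst-case regret as a supremum of integrals -/

/-- Expected regret of BSAA under `F`, as an integral over the order quantity, for samples at the
levels `x`. -/
noncomputable def regretIntegral (q : ℝ) {N : ℕ} (x : Fin N → ℝ) (F : DemandDist) : ℝ :=
  ∫ u in (0 : ℝ)..1, psi q N (levelCount x u) (demandCDF F u)

lemma levelCount_le_card (x : Fin N → ℝ) (u : ℝ) : levelCount x u ≤ N :=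
  (levelCount_le x u).trans_eq (Fintype.card_fin N)

end

section
variable {q : ℝ} {N : ℕ} {x : Fin N → ℝ}

lemma measurable_apply_nat {g : ℕ → ℝ → ℝ} (hg : ∀ k, Measurable (g k)) {c : ℝ → ℕ}
    (hc : Measurable c) {f : ℝ → ℝ} (hf : Measurable f) : Measurable fun u => g (c u) (f u) := by
  have h : Measurable fun p : ℝ × ℕ => g p.2 p.1 := measurable_from_prod_countable_left hg
  exact h.comp (hf.prodMk hc)

lemma measurable_psi_levelCount (q : ℝ) (x : Fin N → ℝ) (F : DemandDist) :
    Measurable fun u => psi q N (levelCount x u) (demandCDF F u) :=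
  measurable_apply_nat (fun k => (continuous_psi q N k).measurable)
    (levelCount_mono x).measurable (demandCDF_mono F).measurable

lemma psi_levelCount_mem (hq0 : 0 ≤ q) (hq1 : q ≤ 1) (x : Fin N → ℝ) (F : DemandDist) (u : ℝ) :
    psi q N (levelCount x u) (demandCDF F u) ∈ Set.Icc (0 : ℝ) 1 :=
  ⟨psi_nonneg hq0 hq1 (levelCount_le_card x u) (demandCDF_nonneg F u) (demandCDF_le_one F u),
    psi_le_one hq0 hq1 (levelCount_le_card x u) (demandCDF_nonneg F u) (demandCDF_le_one F u)⟩

lemma intervalIntegrable_psi_levelCount (hq0 : 0 ≤ q) (hq1 : q ≤ 1) (x : Fin N → ℝ)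
    (F : DemandDist) (a b : ℝ) :
    IntervalIntegrable (fun u => psi q N (levelCount x u) (demandCDF F u)) volume a b := by
  refine intervalIntegrable_of_abs_le (measurable_psi_levelCount q x F) (C := 1) (fun u => ?_) a b
  rw [abs_of_nonneg (psi_levelCount_mem hq0 hq1 x F u).1]
  exact (psi_levelCount_mem hq0 hq1 x F u).2

lemma regretIntegral_le_one (hq0 : 0 ≤ q) (hq1 : q ≤ 1) (x : Fin N → ℝ) (F : DemandDist) :
    regretIntegral q x F ≤ 1 := by
  have := intervalIntegral.integral_mono_on zero_le_one
    (intervalIntegrable_psi_levelCount hq0 hq1 x F 0 1) intervalIntegrable_const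
    (fun u _ => (psi_levelCount_mem hq0 hq1 x F u).2)
  simpa [regretIntegral] using this

/-- A real supremum over an unbounded family is 0 by convention, so boundedness is needed before
comparing with one `F`. -/
lemma bddAbove_regretIntegral (hq0 : 0 ≤ q) (hq1 : q ≤ 1) (x : Fin N → ℝ) :
    BddAbove (Set.range (regretIntegral q x)) :=
  ⟨1, by rintro _ ⟨F, rfl⟩; exact regretIntegral_le_one hq0 hq1 x F⟩

lemma worstCaseRegret_eq (hq0 : 0 ≤ q) (hq1 : q ≤ 1) (hN : 0 < N) {K : ℕ} {n : Fin K → ℕ}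
    (e : Fin N ≃ SampleIdx n) (y : Fin K → ℝ) :
    worstCaseRegret q (bsaa q n) y = ⨆ F, regretIntegral q (fun i => y (e i).1) F := by
  have hcard : Fintype.card (SampleIdx n) = N := by
    rw [← Fintype.card_congr e, Fintype.card_fin]
  refine iSup_congr fun F => ?_
  rw [expectedRegret_bsaa hq0 hq1 (by omega), hcard, regretIntegral]
  simp_rw [← levelCount_comp_equiv e (fun s : SampleIdx n => y s.1)]
  rfl

lemma worstCaseRegret_unit (hq0 : 0 ≤ q) (hq1 : q ≤ 1) (hN : 0 < N) (x : Fin N → ℝ) :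
    worstCaseRegret q (bsaa q (fun _ : Fin N => 1)) x = ⨆ F, regretIntegral q x F :=
  worstCaseRegret_eq hq0 hq1 hN (Equiv.sigmaUnique (Fin N) fun _ => Fin 1).symm x

lemma exists_unit_design (hq0 : 0 ≤ q) (hq1 : q ≤ 1) {B K : ℕ} {n : Fin K → ℕ} {y : Fin K → ℝ}
    (h : IsDesign B n y) : ∃ x : Fin (∑ k, n k) → ℝ, 0 < ∑ k, n k ∧
      IsDesign B (fun _ : Fin (∑ k, n k) => 1) x ∧
      worstCaseRegret q (bsaa q (fun _ : Fin (∑ k, n k) => 1)) x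
        = worstCaseRegret q (bsaa q n) y := by
  have hcard : Fintype.card (SampleIdx n) = ∑ k, n k := by simp
  have hpos : 0 < ∑ k, n k :=
    (h.counts_pos ⟨0, h.levels_pos⟩).trans
      (Finset.single_le_sum (f := n) (fun _ _ => Nat.zero_le _) (Finset.mem_univ _))
  let e₀ : Fin (∑ k, n k) ≃ SampleIdx n := (Fintype.equivFinOfCardEq hcard).symm
  -- Listing the samples one by one in order of level changes neither the budget used nor the
  -- regret.
  let e : Fin (∑ k, n k) ≃ SampleIdx n := (Tuple.sort fun i => y (e₀ i).1).trans e₀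
  refine ⟨fun i => y (e i).1, hpos, ⟨hpos, fun _ => le_rfl, ?_, fun i => h.mem _, ?_⟩, ?_⟩
  · exact Tuple.monotone_sort fun i => y (e₀ i).1
  · refine le_trans (le_of_eq ?_) h.budget
    simp only [Nat.cast_one, one_mul]
    rw [Equiv.sum_comp e fun s : SampleIdx n => y s.1, Fintype.sum_sigma]
    simp
  · rw [worstCaseRegret_unit hq0 hq1 hpos, worstCaseRegret_eq hq0 hq1 hpos e]

lemma integral_cell (hx : Monotone x) (h01 : ∀ i, x i ∈ Set.Icc (0 : ℝ) 1) {k : ℕ} (hk : k ≤ N)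
    {F : DemandDist} {g : ℝ → ℝ} (hg : ∀ u, node x k < u → u < node x (k + 1) →
      psi q N k (demandCDF F u) = g u) :
    ∫ u in (node x k)..(node x (k + 1)), psi q N (levelCount x u) (demandCDF F u)
      = ∫ u in (node x k)..(node x (k + 1)), g u := by
  refine intervalIntegral.integral_congr_ae ?_
  have hne : ∀ᵐ u : ℝ, u ≠ node x (k + 1) := by simp [ae_iff]
  filter_upwards [hne] with u hua hu
  rw [Set.uIoc_of_le (node_le_succ hx h01 hk)] at hu
  have hlt : u < node x (k + 1) := lt_of_le_of_ne hu.2 hua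
  rw [levelCount_eq hx h01 hk hu.1.le hlt, hg u hu.1 hlt]

lemma regretIntegral_eq_sum (hq0 : 0 ≤ q) (hq1 : q ≤ 1) (x : Fin N → ℝ) (F : DemandDist) :
    regretIntegral q x F = ∑ k ∈ Finset.range (N + 1),
      ∫ u in (node x k)..(node x (k + 1)), psi q N (levelCount x u) (demandCDF F u) := by
  rw [intervalIntegral.sum_integral_adjacent_intervals
    (fun k _ => intervalIntegrable_psi_levelCount hq0 hq1 x F _ _), node_zero, node_last,
    regretIntegral]

/-! ### Lower bound on the worst-case regret: two-level distribution functions -/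

open Classical in
lemma exists_two_level {v w c : ℝ} (hv : 0 ≤ v) (hvw : v ≤ w) (hw : w ≤ 1)
    (hc : c ∈ Set.Icc (0 : ℝ) 1) : ∃ F : DemandDist, ∀ u, 0 ≤ u → u < 1 →
      demandCDF F u = if c ≤ u then w else v := by
  -- The remaining mass 1 - w sits at 1, which is why u = 1 is excluded from the conclusion.
  let μ : Measure (Set.Icc (0 : ℝ) 1) :=
    ENNReal.ofReal v • Measure.dirac ⟨0, by simp⟩
      + ENNReal.ofReal (w - v) • Measure.dirac ⟨c, hc⟩
      + ENNReal.ofReal (1 - w) • Measure.dirac ⟨1, by simp⟩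
  have hμ : IsProbabilityMeasure μ := by
    constructor
    simp only [μ, Measure.add_apply, Measure.smul_apply, measure_univ, smul_eq_mul, mul_one]
    rw [← ENNReal.ofReal_add hv (by linarith), ← ENNReal.ofReal_add (by linarith) (by linarith)]
    simp
  refine ⟨⟨μ, hμ⟩, fun u hu0 hu1 => ?_⟩
  have hm := measurableSet_demand_le u
  change (μ {D : Set.Icc (0 : ℝ) 1 | (D : ℝ) ≤ u}).toReal = _
  simp only [μ, Measure.add_apply, Measure.smul_apply, smul_eq_mul, Measure.dirac_apply' _ hm,
    Set.indicator_apply, Set.mem_ofPred_eq, Pi.one_apply]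
  rw [if_pos hu0, if_neg (not_le.2 hu1), mul_one, mul_zero, add_zero]
  split_ifs
  · rw [mul_one, ← ENNReal.ofReal_add hv (by linarith), ENNReal.toReal_ofReal (by linarith)]
    ring
  · rw [mul_zero, add_zero, ENNReal.toReal_ofReal hv]

lemma lowPart_add_highPart_le (hq0 : 0 ≤ q) (hq1 : q ≤ 1) (hN : 0 < N) (hx : Monotone x)
    (h01 : ∀ i, x i ∈ Set.Icc (0 : ℝ) 1) {m : ℕ} (hm : m ≤ N + 1) {v w : ℝ} (hv : 0 ≤ v)
    (hvw : v ≤ w) (hw : w ≤ 1) :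
    lowPart q x m v + highPart q x m w
      ≤ worstCaseRegret q (bsaa q (fun _ : Fin N => 1)) x := by
  obtain ⟨F, hF⟩ := exists_two_level hv hvw hw (node_mem hx h01 hm)
  rw [worstCaseRegret_unit hq0 hq1 hN]
  refine le_trans (le_of_eq ?_) (le_ciSup (bddAbove_regretIntegral hq0 hq1 x) F)
  rw [regretIntegral_eq_sum hq0 hq1, ← Finset.sum_range_add_sum_Ico _ hm, lowPart, highPart]
  congr 1
  · refine Finset.sum_congr rfl fun k hk => ?_
    have hk := Finset.mem_range.1 hk
    rw [integral_cell hx h01 (by omega) (g := fun _ => psi q N k v),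
      intervalIntegral.integral_const, smul_eq_mul]
    intro u h1 h2
    have h3 := node_mono hx h01 (i := k + 1) (j := m) (by omega) hm
    rw [hF u ((node_mem hx h01 (by omega)).1.trans h1.le)
      (h2.trans_le (node_mem hx h01 (by omega)).2), if_neg (by linarith)]
  · refine Finset.sum_congr rfl fun k hk => ?_
    have hk := Finset.mem_Ico.1 hk
    rw [integral_cell hx h01 (by omega) (g := fun _ => psi q N k w),
      intervalIntegral.integral_const, smul_eq_mul]
    intro u h1 h2
    have h3 := node_mono hx h01 hk.1 (by omega)
    rw [hF u ((node_mem hx h01 (by omega)).1.trans h1.le)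
      (h2.trans_le (node_mem hx h01 (by omega)).2), if_pos (by linarith)]

/-! ### Upper bound on the worst-case regret -/

/-- AM-GM: ac + bd ≥ 2√(ab·cd) ≥ 2ab. -/
lemma two_mul_le_add_of_mul_le {a b c d : ℝ} (ha : 0 ≤ a) (hb : 0 ≤ b) (hc : 0 ≤ c) (hd : 0 ≤ d)
    (h : a * b ≤ c * d) : 2 * (a * b) ≤ a * c + b * d := by
  refine abs_le_of_sq_le_sq' ?_ (by positivity) |>.2
  have h1 := mul_le_mul_of_nonneg_left h (mul_nonneg ha hb)
  nlinarith [sq_nonneg (a * c - b * d)]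

/-- For weights `Δ` and nonnegative functions `φ k` whose ratios decrease along `t`, one constant
argument among the `t j` does at least as well as the arguments `t k`. -/
lemma exists_sum_le_sum_const {κ : Type*} {S : Finset κ} (hS : S.Nonempty) {Δ : κ → ℝ}
    {φ : κ → ℝ → ℝ} {t : κ → ℝ} (hΔ : ∀ k ∈ S, 0 ≤ Δ k)
    (hφ : ∀ k ∈ S, ∀ l ∈ S, 0 ≤ φ k (t l))
    (hcross : ∀ k ∈ S, ∀ l ∈ S, φ k (t k) * φ l (t l) ≤ φ k (t l) * φ l (t k)) :
    ∃ j ∈ S, ∑ k ∈ S, Δ k * φ k (t k) ≤ ∑ k ∈ S, Δ k * φ k (t j) := by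
  obtain ⟨j, hj, hmax⟩ := S.exists_max_image (fun j => ∑ k ∈ S, Δ k * φ k (t j)) hS
  refine ⟨j, hj, ?_⟩
  set Z := ∑ k ∈ S, Δ k * φ k (t k)
  set M := ∑ k ∈ S, Δ k * φ k (t j)
  have hM : 0 ≤ M := Finset.sum_nonneg fun k hk => mul_nonneg (hΔ k hk) (hφ k hk j hj)
  rcases le_or_gt Z 0 with hZ | hZ
  · exact hZ.trans hM
  -- `W` averages the values of the constant choices with weights Δ_l φ_l(t_l), of total `Z`, so W ≤
  -- Z M. Pairing (k, l) with (l, k) and applying the cross inequality gives Z² ≤ W; dividing by Z >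
  -- 0 yields Z ≤ M.
  set W := ∑ l ∈ S, Δ l * φ l (t l) * ∑ k ∈ S, Δ k * φ k (t l)
  have hW : W = ∑ l ∈ S, ∑ k ∈ S, Δ l * Δ k * (φ l (t l) * φ k (t l)) := by
    refine Finset.sum_congr rfl fun l _ => ?_
    rw [Finset.mul_sum]
    exact Finset.sum_congr rfl fun k _ => by ring
  have h1 : W ≤ Z * M := by
    rw [Finset.sum_mul]
    exact Finset.sum_le_sum fun l hl =>
      mul_le_mul_of_nonneg_left (hmax l hl) (mul_nonneg (hΔ l hl) (hφ l hl l hl))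
  have h2 : 2 * (Z * Z) ≤ W + W := by
    have hW' : W + W = (∑ l ∈ S, ∑ k ∈ S, Δ l * Δ k * (φ l (t l) * φ k (t l)))
        + ∑ l ∈ S, ∑ k ∈ S, Δ k * Δ l * (φ k (t k) * φ l (t k)) := by
      rw [Finset.sum_comm (f := fun l k => Δ k * Δ l * (φ k (t k) * φ l (t k))), ← hW]
    rw [hW', ← Finset.sum_add_distrib, Finset.sum_mul_sum, Finset.mul_sum]
    refine Finset.sum_le_sum fun l hl => ?_
    rw [← Finset.sum_add_distrib, Finset.mul_sum]
    refine Finset.sum_le_sum fun k hk => ?_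
    have h := two_mul_le_add_of_mul_le (hφ l hl l hl) (hφ k hk k hk) (hφ k hk l hl)
      (hφ l hl k hk) ((hcross l hl k hk).trans_eq (mul_comm _ _))
    have h' := mul_le_mul_of_nonneg_left h (mul_nonneg (hΔ l hl) (hΔ k hk))
    nlinarith
  nlinarith

/-- Some point has a value at least the average; no continuity is needed, so distribution functions
with jumps are covered. -/
lemma exists_integral_le_mul {f : ℝ → ℝ} {a b : ℝ} (hab : a ≤ b)
    (hf : IntervalIntegrable f volume a b) :
    ∃ u ∈ Set.Icc a b, ∫ s in a..b, f s ≤ (b - a) * f u := by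
  rcases hab.eq_or_lt with rfl | h
  · exact ⟨a, by simp, by simp⟩
  have hv : volume (Set.Ioc a b) ≠ 0 := by simp [h]
  obtain ⟨u, hu, hle⟩ := exists_setAverage_le hv (by simp)
    ((intervalIntegrable_iff_integrableOn_Ioc_of_le hab).1 hf)
  refine ⟨u, ⟨hu.1.le, hu.2⟩, ?_⟩
  rw [setAverage_eq, smul_eq_mul, ← intervalIntegral.integral_of_le hab,
    Real.volume_real_Ioc_of_le hab, inv_mul_le_iff₀ (by linarith)] at hle
  exact hle

/-- One value t_k of the distribution function is picked per cell, at least as bad as the cell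
average. The t_k are nondecreasing, hence cross `q` once, and each side is replaced by a constant.
-/
lemma regretIntegral_le (hq0 : 0 ≤ q) (hq1 : q ≤ 1) (hx : Monotone x)
    (h01 : ∀ i, x i ∈ Set.Icc (0 : ℝ) 1) (F : DemandDist) :
    ∃ m ≤ N + 1, ∃ v ∈ Set.Icc 0 q, ∃ w ∈ Set.Icc q 1,
      regretIntegral q x F ≤ lowPart q x m v + highPart q x m w := by
  have hcell : ∀ k, ∃ u, k ≤ N → u ∈ Set.Icc (node x k) (node x (k + 1)) ∧
      ∫ s in (node x k)..(node x (k + 1)), psi q N (levelCount x s) (demandCDF F s)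
        ≤ (node x (k + 1) - node x k) * psi q N k (demandCDF F u) := by
    intro k
    by_cases hk : k ≤ N
    · have hint : IntervalIntegrable (fun s => psi q N k (demandCDF F s)) volume
          (node x k) (node x (k + 1)) := by
        refine intervalIntegrable_of_abs_le
          ((continuous_psi q N k).measurable.comp (demandCDF_mono F).measurable) (C := 1)
          (fun u => ?_) _ _
        have h0 := demandCDF_nonneg F u
        have h1 := demandCDF_le_one F u
        change |psi q N k (demandCDF F u)| ≤ 1
        rw [abs_of_nonneg (psi_nonneg hq0 hq1 hk h0 h1)]
        exact psi_le_one hq0 hq1 hk h0 h1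
      obtain ⟨u, hu, hle⟩ := exists_integral_le_mul (node_le_succ hx h01 hk) hint
      refine ⟨u, fun _ => ⟨hu, ?_⟩⟩
      rwa [integral_cell hx h01 hk fun _ _ _ => rfl]
    · exact ⟨0, fun h => absurd h hk⟩
  choose u hu using hcell
  set t : ℕ → ℝ := fun k => demandCDF F (u k)
  have ht0 : ∀ k, 0 ≤ t k := fun k => demandCDF_nonneg F _
  have ht1 : ∀ k, t k ≤ 1 := fun k => demandCDF_le_one F _
  have htm : ∀ k l, k ≤ l → l ≤ N → t k ≤ t l := by
    intro k l hkl hl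
    rcases hkl.eq_or_lt with rfl | hlt
    · exact le_rfl
    · exact demandCDF_mono F (((hu k (by omega)).1.2.trans
        (node_mono hx h01 (by omega) (by omega))).trans (hu l hl).1.1)
  -- The alternative m = N + 1 covers the case where all N + 1 cells stay below `q`.
  have hex : ∃ m, m = N + 1 ∨ q ≤ t m := ⟨N + 1, Or.inl rfl⟩
  classical
  set m := Nat.find hex
  have hmN : m ≤ N + 1 := Nat.find_min' hex (Or.inl rfl)
  have hlow : ∀ k, k < m → t k ≤ q := fun k hk => by
    have := Nat.find_min hex hk
    push Not at this
    exact this.2.le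
  have hhigh : ∀ k, m ≤ k → k ≤ N → q ≤ t k := fun k hmk hk => by
    rcases Nat.find_spec hex with h | h
    · omega
    · exact h.trans (htm _ _ hmk hk)
  have hΔ : ∀ k ≤ N, 0 ≤ node x (k + 1) - node x k := fun k hk =>
    sub_nonneg.2 (node_le_succ hx h01 hk)
  have hv : ∃ v ∈ Set.Icc 0 q, ∑ k ∈ Finset.range m,
      (node x (k + 1) - node x k) * psi q N k (t k) ≤ lowPart q x m v := by
    rcases Nat.eq_zero_or_pos m with h0 | h0
    · exact ⟨0, ⟨le_rfl, hq0⟩, by simp [h0, lowPart]⟩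
    obtain ⟨j, hj, hle⟩ := exists_sum_le_sum_const (S := Finset.range m)
      (Δ := fun k => node x (k + 1) - node x k) (φ := psi q N) (t := t) ⟨0, by simpa using h0⟩
      (fun k hk => hΔ k (by have := Finset.mem_range.1 hk; omega))
      (fun k hk l _ => psi_nonneg hq0 hq1 (by have := Finset.mem_range.1 hk; omega) (ht0 l) (ht1 l))
      (fun k hk l hl => by
        have hk := Finset.mem_range.1 hk
        have hl := Finset.mem_range.1 hl
        rcases le_total k l with h | h
        · exact psi_cross_low (N := N) hq0 hq1 h (by omega) (ht0 k) (htm _ _ h (by omega)) (hlow l hl)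
        · have := psi_cross_low (N := N) hq0 hq1 h (by omega) (ht0 l) (htm _ _ h (by omega)) (hlow k hk)
          linarith)
    exact ⟨t j, ⟨ht0 j, hlow j (Finset.mem_range.1 hj)⟩, hle⟩
  have hw : ∃ w ∈ Set.Icc q 1, ∑ k ∈ Finset.Ico m (N + 1),
      (node x (k + 1) - node x k) * psi q N k (t k) ≤ highPart q x m w := by
    rcases hmN.eq_or_lt with h0 | h0
    · exact ⟨1, ⟨hq1, le_rfl⟩, by simp [h0, highPart]⟩
    obtain ⟨j, hj, hle⟩ := exists_sum_le_sum_const (S := Finset.Ico m (N + 1))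
      (Δ := fun k => node x (k + 1) - node x k) (φ := psi q N) (t := t) ⟨m, by simpa using h0⟩
      (fun k hk => hΔ k (by have := Finset.mem_Ico.1 hk; omega))
      (fun k hk l _ => psi_nonneg hq0 hq1 (by have := Finset.mem_Ico.1 hk; omega) (ht0 l) (ht1 l))
      (fun k hk l hl => by
        have hk := Finset.mem_Ico.1 hk
        have hl := Finset.mem_Ico.1 hl
        rcases le_total k l with h | h
        · exact psi_cross_high (N := N) hq0 hq1 h (by omega) (hhigh k hk.1 (by omega))
            (htm _ _ h (by omega)) (ht1 l)
        · have := psi_cross_high (N := N) hq0 hq1 h (by omega) (hhigh l hl.1 (by omega))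
            (htm _ _ h (by omega)) (ht1 k)
          linarith)
    have hj := Finset.mem_Ico.1 hj
    exact ⟨t j, ⟨hhigh j hj.1 (by omega), ht1 j⟩, hle⟩
  obtain ⟨v, hvm, hv⟩ := hv
  obtain ⟨w, hwm, hw⟩ := hw
  refine ⟨m, hmN, v, hvm, w, hwm, le_trans ?_ (add_le_add hv hw)⟩
  rw [regretIntegral_eq_sum hq0 hq1, Finset.sum_range_add_sum_Ico _ hmN]
  exact Finset.sum_le_sum fun k hk => (hu k (by have := Finset.mem_range.1 hk; omega)).2

end

/-! ### Worst-case regret and the grid objective -/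

section
variable {q : ℝ} {N : ℕ} {x : Fin N → ℝ}

lemma exists_grid_point {L s : ℝ} (hs0 : 0 ≤ s) (hsL : s ≤ L) {M : ℕ} (hM : 1 ≤ M) :
    ∃ a : Fin (M + 1), |s - L * ((a : ℕ) : ℝ) / M| ≤ L / M := by
  have hM' : (0 : ℝ) < M := by exact_mod_cast hM
  rcases (hs0.trans hsL).eq_or_lt with hL | hL
  · refine ⟨0, ?_⟩
    rw [← hL, le_antisymm (hsL.trans hL.ge) hs0]
    simp
  have h0 : 0 ≤ s * M / L := by positivity
  have hle : ⌊s * M / L⌋₊ ≤ M := by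
    refine Nat.floor_le_of_le ?_
    rw [div_le_iff₀ hL, mul_comm (M : ℝ)]
    exact mul_le_mul_of_nonneg_right hsL hM'.le
  refine ⟨⟨_, Nat.lt_succ_of_le hle⟩, ?_⟩
  have h1 := Nat.floor_le h0
  have h2 := (Nat.lt_floor_add_one (s * M / L)).le
  simp only
  set c : ℝ := (⌊s * M / L⌋₊ : ℝ)
  rw [le_div_iff₀ hL] at h1
  rw [div_le_iff₀ hL] at h2
  have h3 : L * c / M ≤ s := by rw [div_le_iff₀ hM']; linarith
  have h4 : s ≤ L * c / M + L / M := by rw [← add_div, le_div_iff₀ hM']; linarith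
  rw [abs_le]
  constructor <;> linarith [div_nonneg hL.le hM'.le]

lemma gridV_mem (hq0 : 0 ≤ q) {M : ℕ} (hM : 1 ≤ M) (a : Fin (M + 1)) :
    gridV q M a ∈ Set.Icc 0 q := by
  have hM' : (0 : ℝ) < M := by exact_mod_cast hM
  have ha : ((a : ℕ) : ℝ) ≤ M := by exact_mod_cast Nat.lt_succ_iff.1 a.2
  refine ⟨by unfold gridV; positivity, ?_⟩
  rw [gridV, div_le_iff₀ hM']
  exact mul_le_mul_of_nonneg_left ha hq0

lemma gridW_mem (hq1 : q ≤ 1) {M : ℕ} (hM : 1 ≤ M) (b : Fin (M + 1)) :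
    gridW q M b ∈ Set.Icc q 1 := by
  have h := gridV_mem (sub_nonneg.2 hq1) hM b
  rw [gridV] at h
  rw [gridW]
  exact ⟨by linarith [h.1], by linarith [h.2]⟩

lemma sum_psi_le_add (hq0 : 0 ≤ q) (hq1 : q ≤ 1) (hx : Monotone x)
    (h01 : ∀ i, x i ∈ Set.Icc (0 : ℝ) 1) {i j : ℕ} (hij : i ≤ j) (hj : j ≤ N + 1) {s t δ : ℝ}
    (hs : s ∈ Set.Icc (0 : ℝ) 1) (ht : t ∈ Set.Icc (0 : ℝ) 1) (hst : |s - t| ≤ δ) :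
    ∑ k ∈ Finset.Ico i j, (node x (k + 1) - node x k) * psi q N k s
      ≤ (∑ k ∈ Finset.Ico i j, (node x (k + 1) - node x k) * psi q N k t)
        + (N + 2) * δ * (node x j - node x i) := by
  rw [← Finset.sum_Ico_sub _ hij, Finset.mul_sum, ← Finset.sum_add_distrib]
  refine Finset.sum_le_sum fun k hk => ?_
  have hk := Finset.mem_Ico.1 hk
  have hΔ := sub_nonneg.2 (node_le_succ hx h01 (j := k) (by omega))
  have h1 := psi_le_add hq0 hq1 (N := N) (k := k) (by omega) hs.1 hs.2 ht.1 ht.2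
  have h2 : psi q N k s ≤ psi q N k t + (N + 2) * δ :=
    h1.trans (add_le_add le_rfl (mul_le_mul_of_nonneg_left hst (by positivity)))
  have h3 := mul_le_mul_of_nonneg_left h2 hΔ
  linarith

lemma ciSup_fin_add_le {m n : ℕ} {f : Fin (m + 1) → ℝ} {g : Fin (n + 1) → ℝ} {C : ℝ}
    (h : ∀ a b, f a + g b ≤ C) : (⨆ a, f a) + ⨆ b, g b ≤ C := by
  have h1 : ∀ a, f a ≤ C - ⨆ b, g b := fun a => by
    have : ⨆ b, g b ≤ C - f a := ciSup_le fun b => by linarith [h a b]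
    linarith
  linarith [ciSup_le h1]

lemma gridObjective_le {MV MW : ℕ} {C : ℝ} (h : ∀ (m : Fin (N + 2)) (a : Fin (MV + 1))
    (b : Fin (MW + 1)), lowPart q x m (gridV q MV a) + highPart q x m (gridW q MW b) ≤ C) :
    gridObjective q MV MW x ≤ C :=
  ciSup_le fun m => ciSup_fin_add_le (h m)

lemma le_gridObjective {MV MW : ℕ} (m : Fin (N + 2)) (a : Fin (MV + 1)) (b : Fin (MW + 1)) :
    lowPart q x m (gridV q MV a) + highPart q x m (gridW q MW b) ≤ gridObjective q MV MW x := by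
  refine le_trans (add_le_add ?_ ?_) (le_ciSup (f := fun m : Fin (N + 2) =>
    (⨆ a : Fin (MV + 1), lowPart q x (m : ℕ) (gridV q MV a)) +
      ⨆ b : Fin (MW + 1), highPart q x (m : ℕ) (gridW q MW b)) (Set.finite_range _).bddAbove m)
  · exact le_ciSup (f := fun a : Fin (MV + 1) => lowPart q x m (gridV q MV a))
      (Set.finite_range _).bddAbove a
  · exact le_ciSup (f := fun b : Fin (MW + 1) => highPart q x m (gridW q MW b))
      (Set.finite_range _).bddAbove b

lemma gridObjective_le_worstCaseRegret (hq0 : 0 ≤ q) (hq1 : q ≤ 1) {B : ℕ}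
    (hx : IsDesign B (fun _ : Fin N => 1) x) {MV MW : ℕ} (hV : 1 ≤ MV) (hW : 1 ≤ MW) :
    gridObjective q MV MW x ≤ worstCaseRegret q (bsaa q (fun _ : Fin N => 1)) x := by
  refine gridObjective_le fun m a b => ?_
  have h1 := gridV_mem hq0 hV a
  have h2 := gridW_mem hq1 hW b
  exact lowPart_add_highPart_le hq0 hq1 hx.levels_pos hx.mono hx.mem (Nat.lt_succ_iff.1 m.2) h1.1
    (h1.2.trans h2.1) h2.2

/-- The rounding errors of `v` and `w` are weighted by x_m and 1 - x_m, so they add up to a single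
(N + 2)δ. -/
lemma worstCaseRegret_le_gridObjective_add (hq0 : 0 ≤ q) (hq1 : q ≤ 1) {B : ℕ}
    (hx : IsDesign B (fun _ : Fin N => 1) x) {MV MW : ℕ} (hV : 1 ≤ MV) (hW : 1 ≤ MW) {δ : ℝ}
    (hVδ : q / MV ≤ δ) (hWδ : (1 - q) / MW ≤ δ) :
    worstCaseRegret q (bsaa q (fun _ : Fin N => 1)) x
      ≤ gridObjective q MV MW x + (N + 2) * δ := by
  have : Nonempty DemandDist := ⟨(exists_two_level le_rfl le_rfl zero_le_one
    (c := 0) (by simp)).choose⟩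
  rw [worstCaseRegret_unit hq0 hq1 hx.levels_pos]
  refine ciSup_le fun F => ?_
  obtain ⟨m, hm, v, hv, w, hw, hle⟩ := regretIntegral_le hq0 hq1 hx.mono hx.mem F
  obtain ⟨a, ha⟩ := exists_grid_point hv.1 hv.2 hV
  obtain ⟨b, hb⟩ := exists_grid_point (sub_nonneg.2 hw.1) (sub_le_sub_right hw.2 q) hW
  have ha' : |v - gridV q MV a| ≤ δ := ha.trans hVδ
  have hb' : |w - gridW q MW b| ≤ δ := by
    refine le_trans (le_of_eq ?_) (hb.trans hWδ)
    rw [gridW, sub_add_eq_sub_sub]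
  have hva := gridV_mem hq0 hV a
  have hwb := gridW_mem hq1 hW b
  have h1 := sum_psi_le_add hq0 hq1 hx.mono hx.mem (Nat.zero_le m) hm
    ⟨hv.1, hv.2.trans hq1⟩ ⟨hva.1, hva.2.trans hq1⟩ ha'
  have h2 := sum_psi_le_add hq0 hq1 hx.mono hx.mem hm le_rfl
    ⟨hq0.trans hw.1, hw.2⟩ ⟨hq0.trans hwb.1, hwb.2⟩ hb'
  have h3 := le_gridObjective (q := q) (x := x) ⟨m, Nat.lt_succ_of_le hm⟩ a b
  rw [Nat.Ico_zero_eq_range, node_zero] at h1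
  rw [node_last] at h2
  unfold lowPart highPart at hle h3
  simp only at h3
  linarith

/-! ### The uncensored design and large sample sizes -/

lemma worstCaseRegret_nonneg (hq0 : 0 ≤ q) (hq1 : q ≤ 1) {B : ℕ}
    (hx : IsDesign B (fun _ : Fin N => 1) x) :
    0 ≤ worstCaseRegret q (bsaa q (fun _ : Fin N => 1)) x := by
  -- Take m = 0 and both levels equal to `q`, where every ψ_k vanishes.
  refine le_trans (le_of_eq ?_) (lowPart_add_highPart_le hq0 hq1 hx.levels_pos hx.mono hx.mem
    (Nat.zero_le _) hq0 le_rfl hq1)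
  simp [lowPart, highPart, psi]

lemma isDesign_one {B : ℕ} (hB : 1 ≤ B) :
    IsDesign B (fun _ : Fin B => 1) (fun _ : Fin B => (1 : ℝ)) :=
  ⟨hB, fun _ => le_rfl, fun _ _ _ => le_rfl, fun _ => by simp, by simp⟩

lemma uncensoredRegret_eq (hq0 : 0 ≤ q) (hq1 : q ≤ 1) {B : ℕ} (hB : 1 ≤ B) :
    uncensoredRegret q B
      = worstCaseRegret q (bsaa q (fun _ : Fin B => 1)) (fun _ : Fin B => (1 : ℝ)) := by
  have hcard : Fintype.card (SampleIdx fun _ : Fin 1 => B) = B := by simp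
  rw [uncensoredRegret, worstCaseRegret_eq hq0 hq1 hB (Fintype.equivFinOfCardEq hcard).symm,
    worstCaseRegret_unit hq0 hq1 hB]

/-- ψ_0(t) ≤ |t - q|, which is below `q` for 0 < t < 1 because 1 - q ≤ q; this is where q ≥ 1/2
enters. At t = 0 and t = 1 the binomial factor makes ψ_0 vanish. -/
lemma psi_zero_lt (hq : 1 / 2 ≤ q) (hq1 : q < 1) (hN : 1 ≤ N) {t : ℝ} (ht0 : 0 ≤ t)
    (ht1 : t ≤ 1) : psi q N 0 t < q := by
  have hq0 : 0 < q := by linarith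
  rcases le_total t q with h | h
  · rw [psi_of_le hq0.le hq1.le (Nat.zero_le N) h]
    rcases ht0.eq_or_lt with rfl | h0
    · have hr : 0 < ⌈q * (N : ℝ)⌉₊ := Nat.ceil_pos.2 (by positivity)
      have : binomCDF (N - ⌈q * (N : ℝ)⌉₊) (N - 0) (1 - 0) = 0 := by
        refine Finset.sum_eq_zero fun i hi => ?_
        have := Finset.mem_range.1 hi
        rw [sub_zero, sub_self, zero_pow (by omega), mul_zero]
      rw [this, zero_mul]
      exact hq0
    · refine (mul_le_of_le_one_left (by linarith) (binomCDF_le_one (by linarith)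
        (by linarith))).trans_lt (by linarith)
  · rw [psi_of_ge hq0.le hq1.le (Nat.zero_le N) h]
    rcases ht1.eq_or_lt with rfl | h1
    · have : binomCDF (N - ⌈q * (N : ℝ)⌉₊) (N - 0) (1 - 1) = 1 := by
        rw [binomCDF, Finset.sum_range_succ']
        simp
      rw [this, sub_self, zero_mul]
      exact hq0
    · have h2 : 0 ≤ binomCDF (N - ⌈q * (N : ℝ)⌉₊) (N - 0) (1 - t) :=
        binomCDF_nonneg (by linarith) (by linarith)
      exact (mul_le_of_le_one_left (by linarith) (by linarith)).trans_lt (by linarith)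

lemma uncensoredRegret_lt (hq : 1 / 2 ≤ q) (hq1 : q < 1) {B : ℕ} (hB : 1 ≤ B) :
    uncensoredRegret q B < q := by
  have hq0 : 0 ≤ q := by linarith
  have : Nonempty DemandDist := ⟨(exists_two_level le_rfl le_rfl zero_le_one
    (c := 0) (by simp)).choose⟩
  -- A pointwise strict bound need not survive the supremum over `F`; the attained maximum of ψ_0
  -- does.
  obtain ⟨t, ht, hmax⟩ := (isCompact_Icc (a := (0 : ℝ)) (b := 1)).exists_isMaxOn
    ⟨0, by simp⟩ (continuous_psi q B 0).continuousOn
  rw [uncensoredRegret_eq hq0 hq1.le hB, worstCaseRegret_unit hq0 hq1.le hB]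
  refine (ciSup_le fun F => ?_).trans_lt (psi_zero_lt hq hq1 hB ht.1 ht.2)
  have h := intervalIntegral.integral_mono_on_of_le_Ioo zero_le_one
    (intervalIntegrable_psi_levelCount hq0 hq1.le (fun _ : Fin B => (1 : ℝ)) F 0 1)
    (intervalIntegrable_const (c := psi q B 0 t)) fun u hu => by
      have : levelCount (fun _ : Fin B => (1 : ℝ)) u = 0 := by
        unfold levelCount
        simp [hu.2]
      rw [this]
      exact hmax ⟨demandCDF_nonneg F u, demandCDF_le_one F u⟩
  simpa [regretIntegral] using h

lemma uncensoredRegret_nonneg (hq0 : 0 ≤ q) (hq1 : q ≤ 1) {B : ℕ} (hB : 1 ≤ B) :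
    0 ≤ uncensoredRegret q B := by
  rw [uncensoredRegret_eq hq0 hq1 hB]
  exact worstCaseRegret_nonneg hq0 hq1 (isDesign_one hB)

lemma Nmax_denominator (hq : 1 / 2 ≤ q) (hq1 : q < 1) {B : ℕ} (hB : 1 ≤ B) :
    0 < (1 - q) * (1 - uncensoredRegret q B / q) ∧
      (1 - q) * (1 - uncensoredRegret q B / q) ≤ 1 := by
  have hq0 : 0 < q := by linarith
  have h1 : uncensoredRegret q B / q < 1 := by
    rw [div_lt_one hq0]
    exact uncensoredRegret_lt hq hq1 hB
  have h2 : 0 ≤ uncensoredRegret q B / q :=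
    div_nonneg (uncensoredRegret_nonneg hq0.le hq1.le hB) hq0.le
  exact ⟨mul_pos (by linarith) (by linarith), mul_le_one₀ (by linarith) (by linarith) (by linarith)⟩

lemma budget_le_Nmax (hq : 1 / 2 ≤ q) (hq1 : q < 1) {B : ℕ} (hB : 1 ≤ B) : B ≤ Nmax q B := by
  obtain ⟨h1, h2⟩ := Nmax_denominator hq hq1 hB
  have h3 : (B : ℝ) ≤ (B : ℝ) / ((1 - q) * (1 - uncensoredRegret q B / q)) :=
    le_div_self (Nat.cast_nonneg B) h1 h2
  exact_mod_cast h3.trans (Nat.le_ceil _)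

/-- Demand is identically 1 (m = N + 1, v = 0). Past x_r with r = ⌈qN⌉, enough sales are censored
for BSAA to have stopped, and ψ_k(0) = q. -/
lemma mul_one_sub_node_le_worstCaseRegret (hq0 : 0 ≤ q) (hq1 : q ≤ 1) {B : ℕ}
    (hx : IsDesign B (fun _ : Fin N => 1) x) :
    q * (1 - node x ⌈q * (N : ℝ)⌉₊) ≤ worstCaseRegret q (bsaa q (fun _ : Fin N => 1)) x := by
  refine le_trans ?_ (lowPart_add_highPart_le hq0 hq1 hx.levels_pos hx.mono hx.mem
    (m := N + 1) le_rfl le_rfl hq0 hq1)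
  have hr := ceil_mul_le hq1 N
  have hΔ : ∀ k ≤ N, 0 ≤ node x (k + 1) - node x k := fun k hk =>
    sub_nonneg.2 (node_le_succ hx.mono hx.mem hk)
  rw [highPart, Finset.Ico_self, Finset.sum_empty, add_zero, lowPart,
    ← Finset.sum_range_add_sum_Ico _ (Nat.le_succ_of_le hr)]
  have h1 : 0 ≤ ∑ k ∈ Finset.range ⌈q * (N : ℝ)⌉₊, (node x (k + 1) - node x k) * psi q N k 0 :=
    Finset.sum_nonneg fun k hk => by
      have := Finset.mem_range.1 hk
      exact mul_nonneg (hΔ k (by omega)) (psi_nonneg hq0 hq1 (by omega) le_rfl zero_le_one)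
  have h2 : ∑ k ∈ Finset.Ico ⌈q * (N : ℝ)⌉₊ (N + 1), (node x (k + 1) - node x k) * psi q N k 0
      = q * (1 - node x ⌈q * (N : ℝ)⌉₊) := by
    rw [← node_last x, ← Finset.sum_Ico_sub _ (Nat.le_succ_of_le hr), Finset.mul_sum]
    refine Finset.sum_congr rfl fun k hk => ?_
    have := Finset.mem_Ico.1 hk
    rw [psi_of_le hq0 hq1 (by omega) hq0, binomCDF_of_le (by omega)]
    ring
  linarith

/-- The levels x_r, …, x_N number N - r + 1 ≥ (1 - q)N, since r < qN + 1, and each is at least x_r.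
-/
lemma mul_node_le_budget (hq0 : 0 < q) (hq1 : q ≤ 1) {B : ℕ}
    (hx : IsDesign B (fun _ : Fin N => 1) x) :
    (1 - q) * N * node x ⌈q * (N : ℝ)⌉₊ ≤ B := by
  have hN : (0 : ℝ) < N := by exact_mod_cast hx.levels_pos
  have hr0 : 0 < ⌈q * (N : ℝ)⌉₊ := Nat.ceil_pos.2 (by positivity)
  have hr := ceil_mul_le hq1 N
  have hlt := Nat.ceil_lt_add_one (a := q * (N : ℝ)) (by positivity)
  set r := ⌈q * (N : ℝ)⌉₊
  have hsum : ∑ j ∈ Finset.range N, node x (j + 1) ≤ B := by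
    refine le_trans (le_of_eq ?_) hx.budget
    rw [Finset.sum_range]
    exact Finset.sum_congr rfl fun j _ => by rw [node_succ_of_lt x j.2]; simp
  rw [← Finset.sum_range_add_sum_Ico _ (show r - 1 ≤ N by omega)] at hsum
  have h1 : 0 ≤ ∑ j ∈ Finset.range (r - 1), node x (j + 1) := Finset.sum_nonneg fun j hj => by
    have := Finset.mem_range.1 hj
    exact (node_mem hx.mono hx.mem (by omega)).1
  have h2 : (Finset.Ico (r - 1) N).card • node x r ≤ ∑ j ∈ Finset.Ico (r - 1) N, node x (j + 1) :=
    Finset.card_nsmul_le_sum _ _ _ fun j hj => by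
      have := Finset.mem_Ico.1 hj
      exact node_mono hx.mono hx.mem (by omega) (by omega)
  rw [Nat.card_Ico, nsmul_eq_mul, Nat.cast_sub (by omega), Nat.cast_sub (by omega)] at h2
  have h3 : (1 - q) * N * node x r ≤ ((N : ℝ) - (r - (1 : ℕ))) * node x r := by
    refine mul_le_mul_of_nonneg_right ?_ (node_mem hx.mono hx.mem (by omega)).1
    push_cast
    linarith
  linarith

lemma uncensoredRegret_le_worstCaseRegret (hq : 1 / 2 ≤ q) (hq1 : q < 1) {B : ℕ} (hB : 1 ≤ B)
    (hx : IsDesign B (fun _ : Fin N => 1) x) (hN : Nmax q B ≤ N) :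
    uncensoredRegret q B ≤ worstCaseRegret q (bsaa q (fun _ : Fin N => 1)) x := by
  have hq0 : 0 < q := by linarith
  refine le_trans ?_ (mul_one_sub_node_le_worstCaseRegret hq0.le hq1.le hx)
  have h1 := mul_node_le_budget hq0 hq1.le hx
  set y := node x ⌈q * (N : ℝ)⌉₊
  have h2 : (B : ℝ) / ((1 - q) * (1 - uncensoredRegret q B / q)) ≤ N :=
    (Nat.le_ceil _).trans (by exact_mod_cast hN)
  rw [div_le_iff₀ (Nmax_denominator hq hq1 hB).1] at h2
  have hpos : 0 < (1 - q) * N :=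
    mul_pos (by linarith) (by exact_mod_cast hx.levels_pos)
  have h3 : y ≤ 1 - uncensoredRegret q B / q :=
    le_of_mul_le_mul_left (by linarith) hpos
  have h4 := mul_le_mul_of_nonneg_left (le_sub_comm.1 h3) hq0.le
  rwa [mul_div_cancel₀ _ hq0.ne'] at h4

end

/-! ### Minimisers of the grid objective -/

section
variable {q : ℝ} {N B MV MW : ℕ}

lemma continuous_node (j : ℕ) : Continuous fun x : Fin N → ℝ => node x j := by
  unfold node
  split_ifs <;> fun_prop

lemma continuous_ciSup_fin {X : Type*} [TopologicalSpace X] {m : ℕ} {f : Fin (m + 1) → X → ℝ}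
    (hf : ∀ a, Continuous (f a)) : Continuous fun x => ⨆ a, f a x := by
  simp_rw [← Finset.sup'_univ_eq_ciSup]
  exact Continuous.finset_sup'_apply Finset.univ_nonempty fun a _ => hf a

lemma continuous_gridObjective (q : ℝ) (N MV MW : ℕ) :
    Continuous fun x : Fin N → ℝ => gridObjective q MV MW x := by
  have hn := continuous_node (N := N)
  refine continuous_ciSup_fin fun m => (continuous_ciSup_fin fun a => ?_).add
    (continuous_ciSup_fin fun b => ?_)
  · unfold lowPart
    exact continuous_finsetSum _ fun k _ => ((hn (k + 1)).sub (hn k)).mul continuous_const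
  · unfold highPart
    exact continuous_finsetSum _ fun k _ => ((hn (k + 1)).sub (hn k)).mul continuous_const

lemma isCompact_setOf_isDesign (hN : 1 ≤ N) :
    IsCompact {x : Fin N → ℝ | IsDesign B (fun _ : Fin N => 1) x} := by
  have hK : IsCompact (Set.univ.pi fun _ : Fin N => Set.Icc (0 : ℝ) 1) :=
    isCompact_univ_pi fun _ => isCompact_Icc
  have hc : IsClosed ({x : Fin N → ℝ | Monotone x} ∩ {x : Fin N → ℝ | ∑ k, x k ≤ B}) := by
    refine isClosed_monotone.inter (isClosed_le ?_ continuous_const)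
    fun_prop
  convert hK.inter_right hc using 1
  ext x
  simp only [Set.mem_ofPred_eq, Set.mem_inter_iff, Set.mem_pi, Set.mem_univ, true_imp_iff]
  constructor
  · intro h
    exact ⟨h.mem, h.mono, by simpa using h.budget⟩
  · rintro ⟨h1, h2, h3⟩
    exact ⟨hN, fun _ => le_rfl, h2, h1, by simpa using h3⟩

lemma isDesign_zero (hN : 1 ≤ N) : IsDesign B (fun _ : Fin N => 1) (fun _ : Fin N => (0 : ℝ)) :=
  ⟨hN, fun _ => le_rfl, fun _ _ _ => le_rfl, fun _ => by simp, by simp⟩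

lemma exists_gridObjective_eq_gridValue (q : ℝ) (B MV MW : ℕ) (hN : 1 ≤ N) :
    ∃ x : Fin N → ℝ, IsDesign B (fun _ : Fin N => 1) x ∧
      gridObjective q MV MW x = gridValue q B N MV MW ∧
      ∀ y : Fin N → ℝ, IsDesign B (fun _ : Fin N => 1) y →
        gridValue q B N MV MW ≤ gridObjective q MV MW y := by
  obtain ⟨x, hx, hmin⟩ := (isCompact_setOf_isDesign (B := B) hN).exists_isMinOn
    ⟨_, isDesign_zero hN⟩ (continuous_gridObjective q N MV MW).continuousOn
  have hleast : IsLeast {r : ℝ | ∃ x : Fin N → ℝ, IsDesign B (fun _ : Fin N => 1) x ∧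
      r = gridObjective q MV MW x} (gridObjective q MV MW x) := by
    refine ⟨⟨x, hx, rfl⟩, ?_⟩
    rintro _ ⟨y, hy, rfl⟩
    exact hmin hy
  have he : gridValue q B N MV MW = gridObjective q MV MW x := hleast.csInf_eq
  exact ⟨x, hx, he.symm, fun y hy => he.trans_le (hmin hy)⟩

/-! ### The epigraph program -/

lemma affineMap_sum_apply {V ι : Type*} [AddCommGroup V] [Module ℝ V] (s : Finset ι)
    (f : ι → V →ᵃ[ℝ] ℝ) (z : V) : (∑ k ∈ s, f k) z = ∑ k ∈ s, f k z := by
  classical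
  induction s using Finset.induction_on with
  | empty => simp
  | insert a s ha ih => simp [Finset.sum_insert ha, ih]

lemma coord_apply {V : Type} (v : V) (z : V → ℝ) : coord v z = z v := rfl

lemma nodeAff_apply (j : ℕ) (z : EpiVar N → ℝ) : nodeAff N j z = node (levels z) j := by
  unfold nodeAff node
  split_ifs
  · simp
  · rfl
  · simp

/-- The order constraints at j = 0 and j = N encode 0 ≤ x_1 and x_N ≤ 1 through the node
conventions. -/
lemma isDesign_of_node {x : Fin N → ℝ} (hN : 1 ≤ N)
    (h : ∀ j : Fin (N + 1), node x j ≤ node x (j + 1)) (hB : ∑ j, x j ≤ B) :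
    IsDesign B (fun _ : Fin N => 1) x := by
  have hm : ∀ i j, i ≤ j → j ≤ N + 1 → node x i ≤ node x j := by
    intro i j hij
    induction j, hij using Nat.le_induction with
    | base => exact fun _ => le_rfl
    | succ j _ ih => exact fun hj => (ih (by omega)).trans (h ⟨j, by omega⟩)
  have e : ∀ i : Fin N, x i = node x (i + 1) := fun i => (node_succ_of_lt x i.2).symm
  refine ⟨hN, fun _ => le_rfl, fun i j hij => ?_, fun i => ⟨?_, ?_⟩, by simpa using hB⟩
  · rw [e i, e j]
    exact hm _ _ (Nat.succ_le_succ hij) (by omega)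
  · rw [e i, ← node_zero x]
    exact hm _ _ (Nat.zero_le _) (by omega)
  · rw [e i, ← node_last x]
    exact hm _ _ (by omega) le_rfl

lemma feasible_iff (hN : 1 ≤ N) (z : EpiVar N → ℝ) :
    (epigraphLP q B N MV MW).Feasible z ↔ IsDesign B (fun _ : Fin N => 1) (levels z) ∧
      (∀ (m : Fin (N + 2)) (a : Fin (MV + 1)),
        lowPart q (levels z) m (gridV q MV a) ≤ z (EpiVar.α m)) ∧
      (∀ (m : Fin (N + 2)) (b : Fin (MW + 1)),
        highPart q (levels z) m (gridW q MW b) ≤ z (EpiVar.β m)) ∧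
      ∀ m : Fin (N + 2), z (EpiVar.α m) + z (EpiVar.β m) ≤ z EpiVar.t := by
  have ho : ∀ j, (epigraphLP q B N MV MW).con (.order j) z
      = node (levels z) j - node (levels z) (j + 1) := fun j => by
    simp [epigraphLP, nodeAff_apply]
  have hb : (epigraphLP q B N MV MW).con .budget z = ∑ j, levels z j - B := by
    simp [epigraphLP, affineMap_sum_apply, coord_apply, levels]
  have hl : ∀ m a, (epigraphLP q B N MV MW).con (.low m a) z
      = lowPart q (levels z) m (gridV q MV a) - z (EpiVar.α m) := fun m a => by
    simp [epigraphLP, affineMap_sum_apply, coord_apply, nodeAff_apply, lowPart, mul_comm]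
  have hh : ∀ m b, (epigraphLP q B N MV MW).con (.high m b) z
      = highPart q (levels z) m (gridW q MW b) - z (EpiVar.β m) := fun m b => by
    simp [epigraphLP, affineMap_sum_apply, coord_apply, nodeAff_apply, highPart, mul_comm]
  have hs : ∀ m, (epigraphLP q B N MV MW).con (.sum m) z
      = z (EpiVar.α m) + z (EpiVar.β m) - z EpiVar.t := fun m => by
    simp [epigraphLP, coord_apply]
  constructor
  · intro h
    refine ⟨isDesign_of_node hN (fun j => ?_) ?_, fun m a => ?_, fun m b => ?_, fun m => ?_⟩
    · exact sub_nonpos.1 ((ho j).symm.trans_le (h _))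
    · exact sub_nonpos.1 (hb.symm.trans_le (h _))
    · exact sub_nonpos.1 ((hl m a).symm.trans_le (h _))
    · exact sub_nonpos.1 ((hh m b).symm.trans_le (h _))
    · exact sub_nonpos.1 ((hs m).symm.trans_le (h _))
  · rintro ⟨hd, h1, h2, h3⟩ (j | _ | ⟨m, a⟩ | ⟨m, b⟩ | m)
    · rw [ho]
      exact sub_nonpos.2 (node_le_succ hd.mono hd.mem (Nat.lt_succ_iff.1 j.2))
    · rw [hb]
      exact sub_nonpos.2 (by simpa using hd.budget)
    · rw [hl]
      exact sub_nonpos.2 (h1 m a)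
    · rw [hh]
      exact sub_nonpos.2 (h2 m b)
    · rw [hs]
      exact sub_nonpos.2 (h3 m)

lemma gridObjective_le_of_feasible (hN : 1 ≤ N) {z : EpiVar N → ℝ}
    (hz : (epigraphLP q B N MV MW).Feasible z) :
    gridObjective q MV MW (levels z) ≤ (epigraphLP q B N MV MW).obj z := by
  obtain ⟨-, h1, h2, h3⟩ := (feasible_iff hN z).1 hz
  exact gridObjective_le fun m a b => (add_le_add (h1 m a) (h2 m b)).trans (h3 m)

/-- The vector of variables with levels `x` and the least admissible `t`, `α`, `β`. -/
noncomputable def epiPoint (q : ℝ) (MV MW : ℕ) (x : Fin N → ℝ) : EpiVar N → ℝ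
  | .x j => x j
  | .t => gridObjective q MV MW x
  | .α m => ⨆ a : Fin (MV + 1), lowPart q x m (gridV q MV a)
  | .β m => ⨆ b : Fin (MW + 1), highPart q x m (gridW q MW b)

lemma feasible_epiPoint (hN : 1 ≤ N) {x : Fin N → ℝ} (hx : IsDesign B (fun _ : Fin N => 1) x) :
    (epigraphLP q B N MV MW).Feasible (epiPoint q MV MW x) :=
  (feasible_iff hN _).2 ⟨hx,
    fun m => le_ciSup (f := fun a : Fin (MV + 1) => lowPart q x m (gridV q MV a))
      (Set.finite_range _).bddAbove,
    fun m => le_ciSup (f := fun b : Fin (MW + 1) => highPart q x m (gridW q MW b))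
      (Set.finite_range _).bddAbove,
    fun m => le_ciSup (f := fun m : Fin (N + 2) =>
      (⨆ a : Fin (MV + 1), lowPart q x (m : ℕ) (gridV q MV a)) +
        ⨆ b : Fin (MW + 1), highPart q x (m : ℕ) (gridW q MW b)) (Set.finite_range _).bddAbove m⟩

lemma exists_isOptimal (q : ℝ) (B MV MW : ℕ) (hN : 1 ≤ N) :
    ∃ z, (epigraphLP q B N MV MW).IsOptimal z := by
  obtain ⟨x, hx, he, hmin⟩ := exists_gridObjective_eq_gridValue q B MV MW hN
  refine ⟨epiPoint q MV MW x, feasible_epiPoint hN hx, fun z hz => ?_⟩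
  exact (he.trans_le (hmin _ ((feasible_iff hN z).1 hz).1)).trans
    (gridObjective_le_of_feasible hN hz)

lemma obj_eq_of_isOptimal (hN : 1 ≤ N) {z : EpiVar N → ℝ}
    (hz : (epigraphLP q B N MV MW).IsOptimal z) :
    (epigraphLP q B N MV MW).obj z = gridValue q B N MV MW := by
  obtain ⟨x, hx, he, hmin⟩ := exists_gridObjective_eq_gridValue q B MV MW hN
  refine le_antisymm ((hz.2 _ (feasible_epiPoint hN hx)).trans_eq he) ?_
  exact (hmin _ ((feasible_iff hN z).1 hz.1).1).trans (gridObjective_le_of_feasible hN hz.1)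

/-! ### Comparison of the design value with its grid approximation -/

lemma designValue_le (hq0 : 0 ≤ q) (hq1 : q ≤ 1) {x : Fin N → ℝ}
    (hx : IsDesign B (fun _ : Fin N => 1) x) :
    designValue q B ≤ worstCaseRegret q (bsaa q (fun _ : Fin N => 1)) x := by
  refine csInf_le ⟨0, ?_⟩ ⟨N, _, x, hx, rfl⟩
  rintro _ ⟨K, n, y, hy, rfl⟩
  obtain ⟨x, -, hx, he⟩ := exists_unit_design hq0 hq1 hy
  rw [← he]
  exact worstCaseRegret_nonneg hq0 hq1 hx

lemma approxValue_le {MV MW : ℕ → ℕ} (hN : N ∈ Set.Icc 1 (Nmax q B)) :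
    approxValue q B MV MW ≤ gridValue q B N (MV N) (MW N) :=
  csInf_le ((Set.finite_Icc _ _).image _).bddBelow ⟨N, hN, rfl⟩

lemma approxValue_le_designValue (hq : 1 / 2 ≤ q) (hq1 : q < 1) (hB : 1 ≤ B) {MV MW : ℕ → ℕ}
    (hV : ∀ N ∈ Set.Icc 1 (Nmax q B), 1 ≤ MV N) (hW : ∀ N ∈ Set.Icc 1 (Nmax q B), 1 ≤ MW N) :
    approxValue q B MV MW ≤ designValue q B := by
  have hq0 : 0 ≤ q := by linarith
  have key : ∀ N ∈ Set.Icc 1 (Nmax q B), ∀ x : Fin N → ℝ, IsDesign B (fun _ : Fin N => 1) x →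
      approxValue q B MV MW ≤ worstCaseRegret q (bsaa q (fun _ : Fin N => 1)) x := by
    intro N hN x hx
    obtain ⟨-, -, -, hmin⟩ := exists_gridObjective_eq_gridValue q B (MV N) (MW N) hN.1
    exact ((approxValue_le hN).trans (hmin x hx)).trans
      (gridObjective_le_worstCaseRegret hq0 hq1.le hx (hV N hN) (hW N hN))
  refine le_csInf ⟨_, B, _, _, isDesign_one hB, rfl⟩ ?_
  rintro _ ⟨K, n, y, hy, rfl⟩
  obtain ⟨x, hpos, hx, he⟩ := exists_unit_design hq0 hq1.le hy
  rw [← he]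
  rcases le_total (∑ k, n k) (Nmax q B) with h | h
  · exact key _ ⟨hpos, h⟩ x hx
  -- Too many samples: compare with the uncensored design, of admissible size B ≤ N_max.
  · refine le_trans ?_ (uncensoredRegret_le_worstCaseRegret hq hq1 hB hx h)
    rw [uncensoredRegret_eq hq0 hq1.le hB]
    exact key B ⟨hB, budget_le_Nmax hq hq1 hB⟩ _ (isDesign_one hB)

lemma worstCaseRegret_le_gridValue_add (hq0 : 0 ≤ q) (hq1 : q ≤ 1) {ε δ : ℝ} (hε : 0 < ε)
    (hδ : δ = ε / (2 * ((Nmax q B : ℝ) + 2))) (hN : N ∈ Set.Icc 1 (Nmax q B))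
    (hV : 1 ≤ MV ∧ q / (MV : ℝ) ≤ δ) (hW : 1 ≤ MW ∧ (1 - q) / (MW : ℝ) ≤ δ) {x : Fin N → ℝ}
    (hx : IsDesign B (fun _ : Fin N => 1) x)
    (hopt : gridObjective q MV MW x ≤ gridValue q B N MV MW) :
    worstCaseRegret q (bsaa q (fun _ : Fin N => 1)) x ≤ gridValue q B N MV MW + ε := by
  have h := worstCaseRegret_le_gridObjective_add hq0 hq1 hx hV.1 hW.1 hV.2 hW.2
  have hN' : (N : ℝ) ≤ Nmax q B := by exact_mod_cast hN.2
  have h2 : ((N : ℝ) + 2) * δ ≤ ε := by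
    rw [hδ, mul_div_assoc', div_le_iff₀ (by positivity)]
    nlinarith
  linarith

end

end Newsvendor

theorem mainTheorem8 (q : ℝ) (hq : 1 / 2 ≤ q) (hq1 : q < 1) (B : ℕ) (hB : 1 ≤ B)
    (ε : ℝ) (hε : 0 < ε) (δ : ℝ) (hδ : δ = ε / (2 * ((Newsvendor.Nmax q B : ℝ) + 2)))
    -- numbers of cells of the uniform grids `V_N` of `[0, q]` and `W_N` of `[q, 1]`
    (MV MW : ℕ → ℕ)
    (hV : ∀ N ∈ Set.Icc 1 (Newsvendor.Nmax q B), 1 ≤ MV N ∧ q / (MV N : ℝ) ≤ δ)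
    (hW : ∀ N ∈ Set.Icc 1 (Newsvendor.Nmax q B), 1 ≤ MW N ∧ (1 - q) / (MW N : ℝ) ≤ δ) :
    -- `N_max` is well defined and positive
    (Newsvendor.uncensoredRegret q B < q ∧ 1 ≤ Newsvendor.Nmax q B) ∧
    -- every linear program has an optimal solution, and its optimal value is `P̂_N(B; V_N, W_N)`
    (∀ N ∈ Set.Icc 1 (Newsvendor.Nmax q B),
      (∃ z, (Newsvendor.epigraphLP q B N (MV N) (MW N)).IsOptimal z) ∧
      ∀ z, (Newsvendor.epigraphLP q B N (MV N) (MW N)).IsOptimal z →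
        (Newsvendor.epigraphLP q B N (MV N) (MW N)).obj z =
          Newsvendor.gridValue q B N (MV N) (MW N)) ∧
    -- `P̂(B) ≤ P(B) ≤ P̂(B) + ε`
    (Newsvendor.approxValue q B MV MW ≤ Newsvendor.designValue q B ∧
      Newsvendor.designValue q B ≤ Newsvendor.approxValue q B MV MW + ε) ∧
    -- every design that the procedure can return is feasible and `ε`-optimal
    (∀ z : (N : ℕ) → Newsvendor.EpiVar N → ℝ,
      (∀ N ∈ Set.Icc 1 (Newsvendor.Nmax q B),
        (Newsvendor.epigraphLP q B N (MV N) (MW N)).IsOptimal (z N)) →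
      ∀ N' ∈ Set.Icc 1 (Newsvendor.Nmax q B),
        (∀ N ∈ Set.Icc 1 (Newsvendor.Nmax q B),
          Newsvendor.gridValue q B N' (MV N') (MW N') ≤
            Newsvendor.gridValue q B N (MV N) (MW N)) →
        Newsvendor.gridValue q B N' (MV N') (MW N') = Newsvendor.approxValue q B MV MW ∧
        Newsvendor.IsDesign B (fun _ : Fin N' => 1) (Newsvendor.levels (z N')) ∧
        Newsvendor.worstCaseRegret q (Newsvendor.bsaa q (fun _ : Fin N' => 1))
            (Newsvendor.levels (z N')) ≤ Newsvendor.designValue q B + ε) := by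
  have hq0 : 0 ≤ q := by linarith
  have hBN := Newsvendor.budget_le_Nmax hq hq1 hB
  have hle := Newsvendor.approxValue_le_designValue hq hq1 hB (fun N hN => (hV N hN).1)
    (fun N hN => (hW N hN).1)
  have hlevels : ∀ N ∈ Set.Icc 1 (Newsvendor.Nmax q B), ∀ z,
      (Newsvendor.epigraphLP q B N (MV N) (MW N)).IsOptimal z →
      Newsvendor.IsDesign B (fun _ : Fin N => 1) (Newsvendor.levels z) ∧
      Newsvendor.worstCaseRegret q (Newsvendor.bsaa q (fun _ : Fin N => 1)) (Newsvendor.levels z)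
        ≤ Newsvendor.gridValue q B N (MV N) (MW N) + ε := by
    intro N hN z hz
    have hd := ((Newsvendor.feasible_iff hN.1 z).1 hz.1).1
    exact ⟨hd, Newsvendor.worstCaseRegret_le_gridValue_add hq0 hq1.le hε hδ hN (hV N hN) (hW N hN)
      hd ((Newsvendor.gridObjective_le_of_feasible hN.1 hz.1).trans_eq
        (Newsvendor.obj_eq_of_isOptimal hN.1 hz))⟩
  -- `approxValue` is an infimum over a finite nonempty set, hence a minimum.
  have hattained : ∃ N ∈ Set.Icc 1 (Newsvendor.Nmax q B),
      Newsvendor.gridValue q B N (MV N) (MW N) = Newsvendor.approxValue q B MV MW :=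
    (Set.Nonempty.image _ (Set.nonempty_Icc.2 (hB.trans hBN))).csInf_mem
      ((Set.finite_Icc _ _).image _)
  refine ⟨⟨Newsvendor.uncensoredRegret_lt hq hq1 hB, hB.trans hBN⟩,
    fun N hN => ⟨Newsvendor.exists_isOptimal q B (MV N) (MW N) hN.1,
      fun z hz => Newsvendor.obj_eq_of_isOptimal hN.1 hz⟩, ⟨hle, ?_⟩, ?_⟩
  · obtain ⟨N, hN, he⟩ := hattained
    obtain ⟨z, hz⟩ := Newsvendor.exists_isOptimal q B (MV N) (MW N) hN.1
    obtain ⟨hd, hreg⟩ := hlevels N hN z hz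
    rw [← he]
    exact (Newsvendor.designValue_le hq0 hq1.le hd).trans hreg
  · intro z hz N' hN' hmin
    obtain ⟨N, hN, he⟩ := hattained
    have heq : Newsvendor.gridValue q B N' (MV N') (MW N') = Newsvendor.approxValue q B MV MW :=
      le_antisymm ((hmin N hN).trans_eq he) (Newsvendor.approxValue_le hN')
    obtain ⟨hd, hreg⟩ := hlevels N' hN' (z N') (hz N' hN')
    exact ⟨heq, hd, hreg.trans (by rw [heq]; linarith)⟩
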